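/- Let $\mathcal M=(\mathcal S,\mathcal A,P,R,\gamma)$ be a discounted Markov decision process: $\mathcal S$ is a measurable space, $\mathcal A$ is a finite action set, $P$ is a Markov kernel from $\mathcal S\times\mathcal A$ to $\mathcal S$, $R(\cdot|s,a)$ is the reward distribution with mean $r(s,a)$ satisfying $|r(s,a)|\le R_{\max}<\infty$, and $\gamma\in[0,1)$. Let $\Pi$ be the set of Markovian stationary policies (Markov kernels from $\mathcal S$ to $\mathcal A$); $\pi\in\Pi$ is greedy w.r.t. $f$ if $\pi(\cdot|s)$ is carried by $\arg\max_a f(s,a)$ for every $s$. Let $$P^\delta(\mathcal B|s,a)=\int P(ds'|s,a)\,\delta_{(s',a)}(\mathcal B),\qquad P_k=(P^\delta)^{k-1}P,\qquad P_k^\pi(\mathcal B|s,a)=\int P_k(ds'|s,a)\int\pi(da'|s')\,\delta_{(s',a')}(\mathcal B).$$ For $k\ge1$ let $Q_k^\pi(s,a)=\mathbb E\big[\sum_{t\ge0}\gamma^t r(S_t,A_t)\,\big|\,S_0=s,A_0=a\big]$, where $S_{t+1}\sim P(\cdot|S_t,A_t)$ and, for $t\ge1$, $A_t\sim\pi(\cdot|S_t)$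 if $k$ divides $t$ and $A_t=A_{t-1}$ otherwise. Let $Q_k^*=\sup_{\pi\in\Pi}Q_k^\pi$ (pointwise), and let $\pi_k^*$ be any policy greedy w.r.t. $Q_k^*$. Put $$(T^*f)(s,a)=r(s,a)+\gamma\int P(ds'|s,a)\max_{a'}f(s',a'),\qquad (T^\delta f)(s,a)=r(s,a)+\gamma\,(P^\delta f)(s,a).$$ Let $\rho,\nu$ be probability measures on $\mathcal S\times\mathcal A$ and $q\in[1,\infty]$. For a probability measure $\mu$ on $\mathcal S\times\mathcal A$ let $\|\mu\|_{(q)}=\big\|\tfrac{d\mu}{d\nu}\big\|_{L_{q/(q-1)}(\nu)}$ if $\mu\ll\nu$ and $\|\mu\|_{(q)}=+\infty$ otherwise (where $q/(q-1)$ is $\infty$ for $q=1$ and $1$ for $q=\infty$). For $m_1,m_2,m_3\ge0$, $L\ge1$ and policies $\pi,\pi^{(1)},\dots,\pi^{(L)}$, the persistent concentrability coefficients are $$c_1(m_1,m_2,m_3;\pi)=\big\|\rho(P_k^{\pi})^{m_1}(P_k^{\pi_k^*})^{m_2}(P^\delta)^{m_3}\big\|_{(q)},$$ $$c_2(m_1,m_2;\pi^{(1)},\dots,\pi^{(L)})=\big\|\rho(P_k^{\pi^{(L)}})^{m_1}P_k^{\pi^{(L-1)}}\cdots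 P_k^{\pi^{(1)}}(P^\delta)^{m_2}\big\|_{(q)}.$$ Let $p\ge1$ be real, let $k,J\ge1$ be integers with $k\mid J$, and let $r\in[0,1]$. Let $Q^{(0)},\dots,Q^{(J)}$ be measurable functions on $\mathcal S\times\mathcal A$ with $|Q^{(j)}|\le Q_{\max}\le R_{\max}/(1-\gamma)$. For $0\le j<J$ let $\epsilon^{(j)}=T^*Q^{(j)}-Q^{(j+1)}$ if $k\mid j$ and $\epsilon^{(j)}=T^\delta Q^{(j)}-Q^{(j+1)}$ otherwise. Let $\pi^{(J)}$ be any policy greedy w.r.t. $Q^{(J)}$. With $\alpha_j=\frac{(1-\gamma)\gamma^{J-j-1}}{1-\gamma^{J+1}}$ and $d_j=\lfloor j/k\rfloor$, set $$C_{\mathrm{VI},\rho,\nu}(J;r,q)=\Big(\frac{1-\gamma^k}{2}\Big)^2\sup_{\pi_0,\dots,\pi_J\in\Pi}\sum_{j=0}^{J-1}\alpha_j^{2(1-r)}\Big(\sum_{m=0}^\infty\gamma^{km}\Big[c_1\big(m,\tfrac Jk-d_j,k-1-(j\bmod k);\pi_J\big)+c_2\big(m+1,k-1-(j\bmod k);\pi_{k(d_j+1)},\pi_{k(d_j+2)},\dots,\pi_J\big)\Big]\Big)^2,$$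 $$\mathcal E(\epsilon^{(0)},\dots,\epsilon^{(J-1)};r,q)=\sum_{j=0}^{J-1}\alpha_j^{2r}\,\|\epsilon^{(j)}\|_{pq,\nu}^{2p}.$$ Then $$\|Q_k^*-Q_k^{\pi^{(J)}}\|_{p,\rho}\le\frac{2\gamma^k}{(1-\gamma)(1-\gamma^k)}\Big[\frac{2}{1-\gamma}\gamma^{J/p}R_{\max}+C_{\mathrm{VI},\rho,\nu}(J;r,q)^{\frac1{2p}}\,\mathcal E(\epsilon^{(0)},\dots,\epsilon^{(J-1)};r,q)^{\frac1{2p}}\Big],$$ where nothing is claimed if $C_{\mathrm{VI},\rho,\nu}(J;r,q)=+\infty$ and $\mathcal E=0$ (the right-hand side is then read as $+\infty$). -/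

import Mathlib

open MeasureTheory ProbabilityTheory
open scoped ENNReal ProbabilityTheory

/-- A discounted Markov decision process on measurable spaces of states `S` and actions `A`:
transition kernel `P`, reward distribution `R` with finite mean, discount factor `γ ∈ [0,1)`. -/
structure MDP (S A : Type*) [MeasurableSpace S] [MeasurableSpace A] where
  P : Kernel (S × A) S
  markov_P : IsMarkovKernel P
  R : Kernel (S × A) ℝ
  markov_R : IsMarkovKernel R
  integrable_R : ∀ x, Integrable (fun y : ℝ => y) (R x)
  γ : ℝ
  γ_nonneg : 0 ≤ γ
  γ_lt_one : γ < 1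

/-- A Markovian stationary policy. -/
structure Policy (S A : Type*) [MeasurableSpace S] [MeasurableSpace A] where
  kernel : Kernel S A
  markov : IsMarkovKernel kernel

attribute [instance] MDP.markov_P MDP.markov_R Policy.markov

noncomputable section

/-- `π` is greedy with respect to `f`: in each state it plays only maximizers of `f (s, ·)`. -/
def Policy.IsGreedy {S A : Type*} [MeasurableSpace S] [MeasurableSpace A]
    (π : Policy S A) (f : S × A → ℝ) : Prop :=
  ∀ s, π.kernel s {a | ∀ a', f (s, a') ≤ f (s, a)} = 1

namespace MDP

variable {S A : Type*} [MeasurableSpace S] [MeasurableSpace A] (M : MDP S A)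

/-- The expected reward `r(s,a)`. -/
def r (x : S × A) : ℝ := ∫ y, y ∂(M.R x)

/-- The persistent state-action kernel `P^δ`: the state moves by `P`, the action is repeated. -/
def Pδ : Kernel (S × A) (S × A) :=
  M.P ×ₖ Kernel.deterministic Prod.snd measurable_snd

/-- The `k`-persistent transition kernel `P_k = (P^δ)^(k-1) P`
(first `k - 1` steps of `P^δ`, then one step of `P`). -/
def Pk (k : ℕ) : Kernel (S × A) S := M.P ∘ₖ (M.Pδ ^ (k - 1))

/-- The state-action kernel `P_k^π` of the `k`-persistent MDP:
the state moves by `P_k`, and the next action is drawn from `π`. -/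
def Pkπ (k : ℕ) (π : Policy S A) : Kernel (S × A) (S × A) :=
  M.Pk k ⊗ₖ Kernel.prodMkLeft (S × A) π.kernel

/-- The Bellman optimal operator `T^*`. -/
def Topt (f : S × A → ℝ) (x : S × A) : ℝ :=
  M.r x + M.γ * ∫ s', (⨆ a' : A, f (s', a')) ∂(M.P x)

/-- The Bellman persistent operator `T^δ`. -/
def Tδ (f : S × A → ℝ) (x : S × A) : ℝ :=
  M.r x + M.γ * ∫ y, f y ∂(M.Pδ x)

end MDP

section Execution

variable {S A : Type*} [MeasurableSpace S] [MeasurableSpace A]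

/-- The `k`-persistent policy induced by `π`, at time `t = n + 1`. It maps a history
`(S_0, A_0, …, S_n, A_n, S_{n+1})` to a distribution of `A_{n+1}`: a fresh draw from
`π(·|S_{n+1})` if `k ∣ n + 1`, and the previous action `A_n` otherwise. -/
def Policy.persist (π : Policy S A) (k n : ℕ) :
    Kernel ((Π _ : Finset.Iic n, S × A) × S) A :=
  if (n + 1) % k = 0 then π.kernel.comap Prod.snd measurable_snd
  else Kernel.deterministic (fun h => (h.1 ⟨n, Finset.mem_Iic.2 le_rfl⟩).2) (by fun_prop)

instance Policy.persist_markov (π : Policy S A) (k n : ℕ) :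
    IsMarkovKernel (π.persist k n) := by
  unfold Policy.persist
  split_ifs <;> infer_instance

namespace MDP

variable (M : MDP S A)

/-- The conditional law of `(S_{n+1}, A_{n+1})` given `(S_0, A_0, …, S_n, A_n)` when `π` is
executed at persistence `k` in the MDP `M`. -/
def step (k : ℕ) (π : Policy S A) (n : ℕ) : Kernel (Π _ : Finset.Iic n, S × A) (S × A) :=
  (M.P.comap (fun h => h ⟨n, Finset.mem_Iic.2 le_rfl⟩) (by fun_prop)) ⊗ₖ π.persist k n

instance step_markov (k : ℕ) (π : Policy S A) (n : ℕ) : IsMarkovKernel (M.step k π n) := by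
  unfold MDP.step
  infer_instance

/-- The law of the whole trajectory `(S_t, A_t)_{t ∈ ℕ}` started at `(S_0, A_0) = x`, when `π` is
executed at persistence `k` in the MDP `M`. -/
def law (k : ℕ) (π : Policy S A) (x : S × A) : Measure (ℕ → S × A) :=
  Kernel.traj (X := fun _ => S × A) (M.step k π) 0 (fun _ => x)

/-- The `k`-persistent action-value function `Q_k^π`: the expected discounted reward collected
in `M` by `π` executed at persistence `k`. -/
def Qπ (k : ℕ) (π : Policy S A) (x : S × A) : ℝ :=
  ∫ ω, (∑' t : ℕ, M.γ ^ t * M.r (ω t)) ∂(M.law k π x)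

/-- The `k`-persistent optimal action-value function `Q_k^* = sup_π Q_k^π`. -/
def Qopt (k : ℕ) (x : S × A) : ℝ := ⨆ π : Policy S A, M.Qπ k π x

/-- The approximation errors `ε^(j)` of a sequence of iterates `Q^(j)`. -/
def err (k : ℕ) (Q : ℕ → S × A → ℝ) (j : ℕ) (x : S × A) : ℝ :=
  if j % k = 0 then M.Topt (Q j) x - Q (j + 1) x else M.Tδ (Q j) x - Q (j + 1) x

end MDP

end Execution

section Concentrability

open Classical in
/-- `(E_ν |dμ/dν|^(q/(q-1)))^((q-1)/q)`, and `∞` if `μ` is not absolutely continuous with respect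
to `ν`. The conjugate exponent is `∞` (an essential supremum) for `q = 1`, and `1` for `q = ∞`. -/
def densityNorm {X : Type*} [MeasurableSpace X] (q : ℝ≥0∞) (μ ν : Measure X) : ℝ≥0∞ :=
  if μ ≪ ν then eLpNorm (μ.rnDeriv ν) q.conjExponent ν else ⊤

namespace MDP

variable {S A : Type*} [MeasurableSpace S] [MeasurableSpace A] (M : MDP S A)

/-- First persistent concentrability coefficient: the density norm of
`ρ (P_k^π)^m₁ (P_k^{π*})^m₂ (P^δ)^m₃` with respect to `ν`. -/
def cVI₁ (k : ℕ) (q : ℝ≥0∞) (ρ ν : Measure (S × A)) (πstar : Policy S A)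
    (m₁ m₂ m₃ : ℕ) (π : Policy S A) : ℝ≥0∞ :=
  densityNorm q
    (((ρ.bind ⇑(M.Pkπ k π ^ m₁)).bind ⇑(M.Pkπ k πstar ^ m₂)).bind ⇑(M.Pδ ^ m₃)) ν

/-- `chain k π n μ = μ P_k^{π n} P_k^{π (n-1)} ⋯ P_k^{π 1}`. -/
def chain (k : ℕ) (π : ℕ → Policy S A) : ℕ → Measure (S × A) → Measure (S × A)
  | 0, μ => μ
  | n + 1, μ => chain k π n (μ.bind (M.Pkπ k (π (n + 1))))

/-- Second persistent concentrability coefficient of the policies `π 1, …, π L` (`L ≥ 1`): the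
density norm of `ρ (P_k^{π L})^m₁ P_k^{π (L-1)} ⋯ P_k^{π 1} (P^δ)^m₂` with respect to `ν`. -/
def cVI₂ (k : ℕ) (q : ℝ≥0∞) (ρ ν : Measure (S × A)) (m₁ m₂ L : ℕ)
    (π : ℕ → Policy S A) : ℝ≥0∞ :=
  densityNorm q
    ((M.chain k π (L - 1) (ρ.bind ⇑(M.Pkπ k (π L) ^ m₁))).bind ⇑(M.Pδ ^ m₂)) ν

/-- The weights `α_j`, `0 ≤ j < J`. -/
def α (J j : ℕ) : ℝ := (1 - M.γ) * M.γ ^ (J - j - 1) / (1 - M.γ ^ (J + 1))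

/-- `C_{VI,ρ,ν}(J; r, q)`. The supremum runs over sequences `π_0, …, π_J` of policies (later
entries of `π` play no role). For the error made at step `j` the policies in force afterwards are
`π_{k (j/k + 1)}, π_{k (j/k + 2)}, …, π_J`, which are `J/k - j/k` many. -/
def CVI (k : ℕ) (πstar : Policy S A) (ρ ν : Measure (S × A)) (J : ℕ) (r : ℝ) (q : ℝ≥0∞) :
    ℝ≥0∞ :=
  ENNReal.ofReal ((1 - M.γ ^ k) / 2) ^ 2 *
    ⨆ π : ℕ → Policy S A, ∑ j ∈ Finset.range J,
      ENNReal.ofReal (M.α J j) ^ (2 * (1 - r)) *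
        (∑' m : ℕ, ENNReal.ofReal (M.γ ^ (k * m)) *
          (M.cVI₁ k q ρ ν πstar m (J / k - j / k) (k - j % k - 1) (π J) +
            M.cVI₂ k q ρ ν (m + 1) (k - j % k - 1) (J / k - j / k)
              (fun l => π (k * (j / k + l))))) ^ 2

/-- `𝓔(ε^(0), …, ε^(J-1); r, q) = ∑_j α_j^(2r) ‖ε^(j)‖_{pq,ν}^(2p)`. -/
def errAgg (p : ℝ) (ν : Measure (S × A)) (J : ℕ) (ε : ℕ → S × A → ℝ) (r : ℝ) (q : ℝ≥0∞) :
    ℝ≥0∞ :=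
  ∑ j ∈ Finset.range J,
    ENNReal.ofReal (M.α J j) ^ (2 * r) * eLpNorm (ε j) (ENNReal.ofReal p * q) ν ^ (2 * p)

end MDP

end Concentrability

end

/-!
`Q_k^π` and `Q_k^*` are the fixed points of the `k`-step operators `(T^δ)^(k-1) T^π` and
`(T^δ)^(k-1) T^*`. Hence error-free persistent value iteration started at `Q_k^*` returns to it
every `k` steps, and the iterates `Q^(j)` can be compared with that orbit one single step at a time.
Following `π_k^*` at the updates by `T^*` bounds `(Q_k^* - Q^(J))⁺`, and following the policies
greedy with respect to the `Q^(j)` bounds `(Q^(J) - Q_k^*)⁺`, by discounted sums of `|ε^(j)|`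
transported by products of `P^δ` and the `P_k`. A greedy policy satisfies
`Q_k^* - Q_k^π ≤ γ^k P_k^π (Q_k^* - Q_k^π) + γ^k (P_k^{π*} - P_k^π)(Q_k^* - Q)`, and unrolling this
along `π = π^(J)` brings in the sum over `m` of `γ^(km)`.

Normalizing that sum turns the transport of `|ε^(j)|` into a Markov kernel, and the weights `α_j`,
together with that of the initial gap, sum to one, so Jensen's inequality moves the `p`-th power
onto `|ε^(j)|`. Hölder's inequality changes the measure to `ν` at the cost of the concentrability
coefficients, and Cauchy–Schwarz in `j`, with `α_j = α_j^(1-r) α_j^r`, separates these from the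
errors.
-/

noncomputable section

open Filter
open scoped Topology UniformConvergence

section BoundedMeasurable

variable {X Y : Type*} [MeasurableSpace X] [MeasurableSpace Y]

lemma abs_integral_le_of_abs_le {f : X → ℝ} {C : ℝ} (hC : ∀ x, |f x| ≤ C) (μ : Measure X)
    [IsProbabilityMeasure μ] : |∫ x, f x ∂μ| ≤ C := by
  simpa using norm_integral_le_of_norm_le_const (μ := μ) (f := f) (.of_forall hC)

/-- The space of bounded measurable functions, on which the Bellman operators act. -/
structure BddMeasurable (f : X → ℝ) : Prop where
  measurable : Measurable f
  bdd : ∃ C, ∀ x, |f x| ≤ C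

namespace BddMeasurable

lemma zero : BddMeasurable fun _ : X => (0 : ℝ) := ⟨measurable_const, 0, by simp⟩

variable {f g : X → ℝ}

lemma integrable (hf : BddMeasurable f) (μ : Measure X) [IsFiniteMeasure μ] :
    Integrable f μ :=
  let ⟨C, hC⟩ := hf.bdd
  .of_bound hf.measurable.aestronglyMeasurable C (.of_forall hC)

lemma comp (hf : BddMeasurable f) {φ : Y → X} (hφ : Measurable φ) :
    BddMeasurable fun y => f (φ y) :=
  let ⟨C, hC⟩ := hf.bdd
  ⟨hf.measurable.comp hφ, C, fun y => hC (φ y)⟩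

lemma add (hf : BddMeasurable f) (hg : BddMeasurable g) : BddMeasurable fun x => f x + g x :=
  let ⟨C, hC⟩ := hf.bdd
  let ⟨D, hD⟩ := hg.bdd
  ⟨hf.measurable.add hg.measurable, C + D,
    fun x => (abs_add_le _ _).trans (add_le_add (hC x) (hD x))⟩

lemma const_mul (hf : BddMeasurable f) (c : ℝ) : BddMeasurable fun x => c * f x :=
  let ⟨C, hC⟩ := hf.bdd
  ⟨hf.measurable.const_mul c, |c| * C, fun x => by
    rw [abs_mul]; exact mul_le_mul_of_nonneg_left (hC x) (abs_nonneg c)⟩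

lemma sub (hf : BddMeasurable f) (hg : BddMeasurable g) : BddMeasurable fun x => f x - g x := by
  simpa only [neg_one_mul, ← sub_eq_add_neg] using hf.add (hg.const_mul (-1))

lemma sum {ι : Type*} {F : ι → X → ℝ} (hF : ∀ i, BddMeasurable (F i)) (s : Finset ι) :
    BddMeasurable fun x => ∑ i ∈ s, F i x := by
  induction s using Finset.cons_induction with
  | empty => simpa only [Finset.sum_empty] using zero
  | cons i s hi ih => simpa only [Finset.sum_cons] using (hF i).add ih

lemma integral_kernel {f : Y → ℝ} (hf : BddMeasurable f) (κ : Kernel X Y) [IsMarkovKernel κ] :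
    BddMeasurable fun x => ∫ y, f y ∂κ x :=
  let ⟨C, hC⟩ := hf.bdd
  ⟨hf.measurable.stronglyMeasurable.integral_kernel.measurable, C,
    fun _ => abs_integral_le_of_abs_le hC _⟩

lemma integral_kernel_prodMk {f : X × Y → ℝ} (hf : BddMeasurable f) (κ : Kernel X Y)
    [IsMarkovKernel κ] : BddMeasurable fun x => ∫ y, f (x, y) ∂κ x :=
  let ⟨C, hC⟩ := hf.bdd
  ⟨(hf.measurable.stronglyMeasurable.integral_kernel_prod_right').measurable, C,
    fun x => abs_integral_le_of_abs_le (fun y => hC (x, y)) _⟩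

lemma iSup_snd [Finite Y] [Nonempty Y] {f : X × Y → ℝ} (hf : BddMeasurable f) :
    BddMeasurable fun x => ⨆ y, f (x, y) := by
  obtain ⟨C, hC⟩ := hf.bdd
  have y₀ : Y := Classical.arbitrary Y
  refine ⟨Measurable.iSup fun y => hf.measurable.comp measurable_prodMk_right, C, fun x =>
    abs_le.2 ⟨?_, ciSup_le fun y => le_of_abs_le (hC (x, y))⟩⟩
  exact (neg_le_of_abs_le (hC (x, y₀))).trans (Finite.le_ciSup (fun y => f (x, y)) y₀)

lemma edist_ne_top (hf : BddMeasurable f) (hg : BddMeasurable g) :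
    edist (UniformFun.ofFun f) (UniformFun.ofFun g) ≠ ⊤ := by
  obtain ⟨C, hC⟩ := (hf.sub hg).bdd
  refine ne_top_of_le_ne_top ENNReal.ofReal_ne_top (b := ENNReal.ofReal C)
    (UniformFun.edist_le.2 fun x => ?_)
  rw [edist_dist, Real.dist_eq]
  exact ENNReal.ofReal_le_ofReal (hC x)

lemma isClosed : IsClosed {f : X →ᵤ ℝ | BddMeasurable (UniformFun.toFun f)} := by
  refine isClosed_of_closure_subset fun f hf => ?_
  obtain ⟨F, hF, hFf⟩ := mem_closure_iff_seq_limit.1 hf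
  have hunif := UniformFun.tendsto_iff_tendstoUniformly.1 hFf
  obtain ⟨n, hn⟩ := (Metric.tendstoUniformly_iff.1 hunif 1 one_pos).exists
  obtain ⟨C, hC⟩ := (hF n).bdd
  refine ⟨measurable_of_tendsto_metrizable (fun n => (hF n).measurable)
    (tendsto_pi_nhds.2 hunif.tendsto_at), 1 + C, fun x => ?_⟩
  calc |UniformFun.toFun f x|
      ≤ |UniformFun.toFun f x - UniformFun.toFun (F n) x| + |UniformFun.toFun (F n) x| := by
        simpa using abs_add_le (UniformFun.toFun f x - UniformFun.toFun (F n) x)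
          (UniformFun.toFun (F n) x)
    _ ≤ 1 + C := add_le_add (hn x).le (hC x)

lemma exists_fixedPoint {T : (X → ℝ) → X → ℝ} {β : ℝ} (hβ₀ : 0 ≤ β) (hβ₁ : β < 1)
    (hT : ∀ f, BddMeasurable f → BddMeasurable (T f))
    (hcontr : ∀ f g, BddMeasurable f → BddMeasurable g → ∀ C, (∀ x, |f x - g x| ≤ C) →
      ∀ x, |T f x - T g x| ≤ β * C) :
    ∃ W, BddMeasurable W ∧ T W = W := by
  let s : Set (X →ᵤ ℝ) := {f | BddMeasurable (UniformFun.toFun f)}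
  let F : (X →ᵤ ℝ) → X →ᵤ ℝ := fun f => UniformFun.ofFun (T (UniformFun.toFun f))
  have hmaps : Set.MapsTo F s s := fun f hf => hT _ hf
  have hlip (f g : X →ᵤ ℝ) (hf : f ∈ s) (hg : g ∈ s) :
      edist (F f) (F g) ≤ β.toNNReal * edist f g := by
    have htop : edist f g ≠ ⊤ := edist_ne_top hf hg
    refine UniformFun.edist_le.2 fun x => ?_
    rw [← ENNReal.ofReal_toReal htop, ENNReal.ofNNReal_toNNReal, ← ENNReal.ofReal_mul hβ₀,
      edist_dist]
    refine ENNReal.ofReal_le_ofReal (hcontr _ _ hf hg _ (fun y => ?_) x)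
    rw [← Real.dist_eq, dist_edist]
    exact ENNReal.toReal_mono htop UniformFun.edist_eval_le
  have hFs : ContractingWith β.toNNReal (hmaps.restrict F s s) :=
    ⟨by simpa using hβ₁, fun f g => hlip f g f.2 g.2⟩
  obtain ⟨W, hW, hfix, -⟩ := hFs.exists_fixedPoint' isClosed.isComplete hmaps
    (x := UniformFun.ofFun fun _ => 0) zero (edist_ne_top zero (hT _ zero))
  exact ⟨UniformFun.toFun W, hW, hfix⟩

end BddMeasurable

lemma nonpos_of_le_mul_integral (κ : Kernel X X) [IsMarkovKernel κ] {β : ℝ} (hβ₀ : 0 ≤ β)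
    (hβ₁ : β < 1) {h : X → ℝ} (hh : BddMeasurable h) (hle : ∀ x, h x ≤ β * ∫ y, h y ∂κ x)
    (x : X) : h x ≤ 0 := by
  obtain ⟨C, hC⟩ := hh.bdd
  have hpow (n : ℕ) : ∀ x, h x ≤ β ^ n * C := by
    induction n with
    | zero => exact fun x => by simpa using (le_abs_self _).trans (hC x)
    | succ n ih =>
      intro x
      calc h x ≤ β * ∫ y, h y ∂κ x := hle x
        _ ≤ β * ∫ _, β ^ n * C ∂κ x := by
            gcongr
            exacts [hh.integrable _, integrable_const _, ih]
        _ = β ^ (n + 1) * C := by simp; ring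
  have hlim : Tendsto (fun n : ℕ => β ^ n * C) atTop (𝓝 0) := by
    simpa using (tendsto_pow_atTop_nhds_zero_of_lt_one hβ₀ hβ₁).mul_const C
  exact ge_of_tendsto' hlim fun n => hpow n x

end BoundedMeasurable

instance isMarkovKernel_pow {X : Type*} [MeasurableSpace X] (κ : Kernel X X) [IsMarkovKernel κ]
    (n : ℕ) : IsMarkovKernel (κ ^ n) := by
  induction n with
  | zero => exact inferInstanceAs (IsMarkovKernel (Kernel.id : Kernel X X))
  | succ n ih => exact inferInstanceAs (IsMarkovKernel ((κ ^ n) ∘ₖ κ))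

lemma kernel_pow_succ' {X : Type*} [MeasurableSpace X] (κ : Kernel X X) (n : ℕ) :
    κ ^ (n + 1) = κ ∘ₖ (κ ^ n) := by
  rw [pow_succ']; rfl

lemma hasSum_integral_discounted {Ω : Type*} [MeasurableSpace Ω] (μ : Measure Ω)
    [IsProbabilityMeasure μ] {β : ℝ} (hβ₀ : 0 ≤ β) (hβ₁ : β < 1) {f : ℕ → Ω → ℝ} {C : ℝ}
    (hf : ∀ t, Measurable (f t)) (hC : ∀ t ω, |f t ω| ≤ C) :
    HasSum (fun t => β ^ t * ∫ ω, f t ω ∂μ) (∫ ω, ∑' t, β ^ t * f t ω ∂μ) := by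
  have hint (t : ℕ) : Integrable (fun ω => β ^ t * f t ω) μ :=
    (BddMeasurable.const_mul ⟨hf t, C, hC t⟩ _).integrable μ
  have hnorm (t : ℕ) : ∫ ω, ‖β ^ t * f t ω‖ ∂μ ≤ β ^ t * C := by
    refine (le_abs_self _).trans (abs_integral_le_of_abs_le (fun ω => ?_) μ)
    rw [Real.norm_eq_abs, abs_abs, abs_mul, abs_of_nonneg (pow_nonneg hβ₀ t)]
    exact mul_le_mul_of_nonneg_left (hC t ω) (pow_nonneg hβ₀ t)
  have hsum : Summable fun t => ∫ ω, ‖β ^ t * f t ω‖ ∂μ :=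
    .of_nonneg_of_le (fun t => integral_nonneg fun ω => norm_nonneg _) hnorm
      ((summable_geometric_of_lt_one hβ₀ hβ₁).mul_right C)
  simpa only [integral_const_mul] using hasSum_integral_of_summable_integral_norm hint hsum

namespace MDP

variable {S A : Type*} [MeasurableSpace S] [MeasurableSpace A] (M : MDP S A)

section Value

instance isMarkovKernel_Pδ : IsMarkovKernel M.Pδ := by unfold Pδ; infer_instance

instance isMarkovKernel_Pk (k : ℕ) : IsMarkovKernel (M.Pk k) := by unfold Pk; infer_instance

instance isMarkovKernel_Pkπ (k : ℕ) (π : Policy S A) : IsMarkovKernel (M.Pkπ k π) := by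
  unfold Pkπ; infer_instance

lemma Pk_one : M.Pk 1 = M.P := Kernel.comp_id _

lemma Pkπ_one_comp (k : ℕ) (π : Policy S A) :
    M.Pkπ 1 π ∘ₖ (M.Pδ ^ (k - 1)) = M.Pkπ k π := by
  rw [Pkπ, Pkπ, Pk_one, Kernel.compProd_prodMkLeft_eq_comp, Kernel.compProd_prodMkLeft_eq_comp,
    Kernel.comp_assoc, Pk]

/-- The transition kernel of the state-action process into time `t`, when `π` is executed at
persistence `k`: the action is redrawn at the multiples of `k` and repeated otherwise. -/
def stepKernel (k : ℕ) (π : Policy S A) (t : ℕ) : Kernel (S × A) (S × A) :=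
  if t % k = 0 then M.Pkπ 1 π else M.Pδ

instance isMarkovKernel_stepKernel (k : ℕ) (π : Policy S A) (t : ℕ) :
    IsMarkovKernel (M.stepKernel k π t) := by
  unfold stepKernel; split_ifs <;> infer_instance

lemma step_eq_comap (k : ℕ) (π : Policy S A) (n : ℕ) :
    M.step k π n =
      (M.stepKernel k π (n + 1)).comap (fun h => h ⟨n, Finset.mem_Iic.2 le_rfl⟩)
        (by fun_prop) := by
  ext h s hs
  rw [step, Kernel.compProd_apply hs, Kernel.comap_apply, Kernel.comap_apply, stepKernel]
  split_ifs with hn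
  · rw [Pkπ, Pk_one, Kernel.compProd_apply hs]
    simp [Policy.persist, hn, Kernel.comap_apply]
  · rw [Pδ, Kernel.prod_apply' _ _ _ hs]
    simp [Policy.persist, hn, Kernel.deterministic_apply]

/-- The law of `(S_t, A_t)` as a kernel in `(S_0, A_0)`. -/
def marginal (k : ℕ) (π : Policy S A) : ℕ → Kernel (S × A) (S × A)
  | 0 => Kernel.id
  | t + 1 => M.stepKernel k π (t + 1) ∘ₖ marginal k π t

instance isMarkovKernel_marginal (k : ℕ) (π : Policy S A) (t : ℕ) :
    IsMarkovKernel (M.marginal k π t) := by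
  induction t with
  | zero => unfold marginal; infer_instance
  | succ t ih => unfold marginal; infer_instance

instance isProbabilityMeasure_law (k : ℕ) (π : Policy S A) (x : S × A) :
    IsProbabilityMeasure (M.law k π x) := by unfold law; infer_instance

lemma law_map_eval_eq_partialTraj (k : ℕ) (π : Policy S A) (x : S × A) (t : ℕ) :
    (M.law k π x).map (fun ω => ω t) =
      (Kernel.partialTraj (X := fun _ => S × A) (M.step k π) 0 t (fun _ => x)).map
        (fun h => h ⟨t, Finset.mem_Iic.2 le_rfl⟩) := by
  rw [law, ← Kernel.traj_map_frestrictLe_apply, Measure.map_map (by fun_prop) (by fun_prop)]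
  rfl

lemma law_map_eval_succ (k : ℕ) (π : Policy S A) (x : S × A) (t : ℕ) :
    (M.law k π x).map (fun ω => ω (t + 1)) =
      M.stepKernel k π (t + 1) ∘ₘ (M.law k π x).map (fun ω => ω t) := by
  have hstep : (M.law k π x).map (fun ω => ω (t + 1)) = M.step k π t ∘ₘ
      Kernel.partialTraj (X := fun _ => S × A) (M.step k π) 0 t (fun _ => x) := by
    rw [← Measure.snd_compProd, Kernel.partialTraj_compProd_eq_map_traj (Nat.zero_le t),
      Measure.snd, Measure.map_map measurable_snd (by fun_prop)]
    rfl
  rw [hstep, law_map_eval_eq_partialTraj, step_eq_comap]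
  ext s hs
  rw [Measure.bind_apply hs (Kernel.aemeasurable _), Measure.bind_apply hs
    (Kernel.aemeasurable _), lintegral_map (Kernel.measurable_coe _ hs) (by fun_prop)]
  rfl

lemma law_map_eval (k : ℕ) (π : Policy S A) (x : S × A) (t : ℕ) :
    (M.law k π x).map (fun ω => ω t) = M.marginal k π t x := by
  induction t with
  | zero =>
    rw [law_map_eval_eq_partialTraj, Kernel.partialTraj_self, Kernel.id_apply,
      Measure.map_dirac' (by fun_prop), marginal, Kernel.id_apply]
  | succ t ih => rw [law_map_eval_succ, ih, marginal, Kernel.comp_apply]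

lemma marginal_of_lt {k : ℕ} (π : Policy S A) {t : ℕ} (ht : t < k) :
    M.marginal k π t = M.Pδ ^ t := by
  induction t with
  | zero => rfl
  | succ t ih =>
    rw [marginal, ih (by omega), stepKernel, if_neg (by rw [Nat.mod_eq_of_lt ht]; omega),
      kernel_pow_succ']

lemma marginal_self {k : ℕ} (hk : 1 ≤ k) (π : Policy S A) : M.marginal k π k = M.Pkπ k π := by
  obtain ⟨n, rfl⟩ := Nat.exists_eq_add_of_le' hk
  rw [marginal, marginal_of_lt _ π n.lt_succ_self, stepKernel, if_pos (Nat.mod_self _),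
    ← Pkπ_one_comp _ (n + 1), Nat.add_sub_cancel]

lemma marginal_add {k : ℕ} (hk : 1 ≤ k) (π : Policy S A) (t : ℕ) :
    M.marginal k π (t + k) = M.marginal k π t ∘ₖ M.Pkπ k π := by
  induction t with
  | zero => rw [zero_add, marginal_self M hk, marginal, Kernel.id_comp]
  | succ t ih =>
    have hperiod : M.stepKernel k π (t + k + 1) = M.stepKernel k π (t + 1) := by
      rw [stepKernel, stepKernel, add_right_comm, Nat.add_mod_right]
    rw [add_right_comm, marginal, ih, hperiod, marginal, Kernel.comp_assoc]

/-- The expected discounted reward collected in the first `n` steps under a repeated action. -/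
def rk (n : ℕ) (x : S × A) : ℝ := ∑ t ∈ Finset.range n, M.γ ^ t * ∫ y, M.r y ∂((M.Pδ ^ t) x)

variable {M} {Rmax : ℝ}

lemma bddMeasurable_r (hR : ∀ x, |M.r x| ≤ Rmax) : BddMeasurable M.r :=
  ⟨measurable_id.stronglyMeasurable.integral_kernel.measurable, Rmax, hR⟩

lemma bddMeasurable_rk (hR : ∀ x, |M.r x| ≤ Rmax) (n : ℕ) : BddMeasurable (M.rk n) :=
  .sum (fun _ => ((bddMeasurable_r hR).integral_kernel _).const_mul _) _

lemma hasSum_Qπ (hR : ∀ x, |M.r x| ≤ Rmax) (k : ℕ) (π : Policy S A) (x : S × A) :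
    HasSum (fun t => M.γ ^ t * ∫ y, M.r y ∂(M.marginal k π t x)) (M.Qπ k π x) := by
  have hr := (bddMeasurable_r hR).measurable
  have hmarginal (t : ℕ) :
      ∫ ω, M.r (ω t) ∂(M.law k π x) = ∫ y, M.r y ∂(M.marginal k π t x) := by
    rw [← law_map_eval,
      integral_map (measurable_pi_apply t).aemeasurable hr.aestronglyMeasurable]
  simpa only [hmarginal, Qπ] using hasSum_integral_discounted (M.law k π x) M.γ_nonneg M.γ_lt_one
    (f := fun t ω => M.r (ω t)) (fun t => hr.comp (measurable_pi_apply t)) fun t ω => hR (ω t)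

lemma abs_Qπ_le (hR : ∀ x, |M.r x| ≤ Rmax) (k : ℕ) (π : Policy S A) (x : S × A) :
    |M.Qπ k π x| ≤ Rmax / (1 - M.γ) := by
  rw [← (hasSum_Qπ hR k π x).tsum_eq, div_eq_inv_mul, ← Real.norm_eq_abs]
  refine tsum_of_norm_bounded
    ((hasSum_geometric_of_lt_one M.γ_nonneg M.γ_lt_one).mul_right Rmax) fun t => ?_
  rw [Real.norm_eq_abs, abs_mul, abs_of_nonneg (pow_nonneg M.γ_nonneg t)]
  exact mul_le_mul_of_nonneg_left (abs_integral_le_of_abs_le hR _) (pow_nonneg M.γ_nonneg t)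

lemma bddMeasurable_Qπ (hR : ∀ x, |M.r x| ≤ Rmax) (k : ℕ) (π : Policy S A) :
    BddMeasurable (M.Qπ k π) := by
  refine ⟨measurable_of_tendsto_metrizable (fun n => ?_) (tendsto_pi_nhds.2 fun x =>
    (hasSum_Qπ hR k π x).tendsto_sum_nat), _, abs_Qπ_le hR k π⟩
  exact (BddMeasurable.sum (fun t =>
    ((bddMeasurable_r hR).integral_kernel (M.marginal k π t)).const_mul (M.γ ^ t)) _).measurable

lemma Qπ_eq_rk_add (hR : ∀ x, |M.r x| ≤ Rmax) {k : ℕ} (hk : 1 ≤ k) (π : Policy S A)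
    (x : S × A) :
    M.Qπ k π x = M.rk k x + M.γ ^ k * ∫ y, M.Qπ k π y ∂(M.Pkπ k π x) := by
  have hr := bddMeasurable_r hR
  have htail : HasSum (fun t => M.γ ^ t * ∫ y, ∫ z, M.r z ∂(M.marginal k π t y) ∂(M.Pkπ k π x))
      (∫ y, M.Qπ k π y ∂(M.Pkπ k π x)) := by
    simpa only [(hasSum_Qπ hR k π _).tsum_eq] using
      hasSum_integral_discounted (M.Pkπ k π x) M.γ_nonneg M.γ_lt_one
        (f := fun t y => ∫ z, M.r z ∂(M.marginal k π t y))
        (fun t => (hr.integral_kernel _).measurable) fun t y => abs_integral_le_of_abs_le hR _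
  have h := hasSum_Qπ hR k π x
  rw [← h.tsum_eq, ← h.summable.sum_add_tsum_nat_add k, ← htail.tsum_eq, ← tsum_mul_left]
  congr 1
  · exact Finset.sum_congr rfl fun t ht => by rw [marginal_of_lt _ _ (Finset.mem_range.1 ht)]
  · refine tsum_congr fun t => ?_
    rw [marginal_add _ hk, Kernel.integral_comp (hr.integrable _), pow_add]
    ring

end Value

end MDP

namespace Policy

variable {S A : Type*} [MeasurableSpace S] [MeasurableSpace A] [Finite A] {f : S × A → ℝ}

lemma exists_isGreedy [Nonempty A] (hf : Measurable f) : ∃ π : Policy S A, π.IsGreedy f := by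
  classical
  obtain ⟨e, he⟩ := exists_surjective_nat A
  have hex (s : S) : ∃ n, ∀ a', f (s, a') ≤ f (s, e n) := by
    obtain ⟨a, ha⟩ := Finite.exists_max fun a => f (s, a)
    obtain ⟨n, rfl⟩ := he a
    exact ⟨n, ha⟩
  have hmeas : Measurable fun s => e (Nat.find (hex s)) := by
    refine Measurable.find (f := fun n _ => e n) (fun n => measurable_const) (fun n => ?_) hex
    rw [Set.ofPred_forall]
    exact .iInter fun a' => measurableSet_le
      (hf.comp measurable_prodMk_right) (hf.comp measurable_prodMk_right)
  refine ⟨⟨Kernel.deterministic _ hmeas, inferInstance⟩, fun s => ?_⟩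
  rw [Kernel.deterministic_apply]
  exact Measure.dirac_apply_of_mem (Nat.find_spec (hex s))

lemma integral_le_iSup (π : Policy S A) (hf : BddMeasurable f) (s : S) :
    ∫ a, f (s, a) ∂π.kernel s ≤ ⨆ a, f (s, a) :=
  (integral_mono ((hf.comp measurable_prodMk_left).integrable _) (integrable_const _)
    (Finite.le_ciSup fun a => f (s, a))).trans (by simp)

lemma IsGreedy.integral_eq_iSup {π : Policy S A} (hf : Measurable f) (hπ : π.IsGreedy f) (s : S) :
    ∫ a, f (s, a) ∂π.kernel s = ⨆ a, f (s, a) := by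
  have hmeas : MeasurableSet {a | ∀ a', f (s, a') ≤ f (s, a)} := by
    rw [Set.ofPred_forall]
    exact .iInter fun a' => measurableSet_le measurable_const (hf.comp measurable_prodMk_left)
  have hae : ∀ᵐ a ∂π.kernel s, f (s, a) = ⨆ a', f (s, a') := by
    filter_upwards [(prob_compl_eq_zero_iff hmeas).2 (hπ s)] with a ha
    have : Nonempty A := ⟨a⟩
    exact le_antisymm (Finite.le_ciSup (fun a => f (s, a)) a) (ciSup_le ha)
  simp [integral_congr_ae hae]

end Policy

namespace MDP

variable {S A : Type*} [MeasurableSpace S] [MeasurableSpace A] (M : MDP S A)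

section Optimality

/-- The Bellman optimal operator `T_n^*` of the `n`-persistent process. -/
def Tk (n : ℕ) (f : S × A → ℝ) (x : S × A) : ℝ :=
  M.rk n x + M.γ ^ n * ∫ s', (⨆ a' : A, f (s', a')) ∂(M.Pk n x)

variable {M} {Rmax : ℝ}

lemma γ_pow_lt_one {k : ℕ} (hk : 1 ≤ k) : M.γ ^ k < 1 :=
  pow_lt_one₀ M.γ_nonneg M.γ_lt_one (by omega)

lemma integral_Pkπ (k : ℕ) (π : Policy S A) {f : S × A → ℝ} (hf : BddMeasurable f) (x : S × A) :
    ∫ y, f y ∂(M.Pkπ k π x) = ∫ s', ∫ a', f (s', a') ∂(π.kernel s') ∂(M.Pk k x) :=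
  ProbabilityTheory.integral_compProd (hf.integrable (M.Pkπ k π x))

variable [Finite A] {f g : S × A → ℝ}

lemma Tk_eq_of_isGreedy (n : ℕ) {π : Policy S A} (hf : BddMeasurable f) (hπ : π.IsGreedy f)
    (x : S × A) : M.Tk n f x = M.rk n x + M.γ ^ n * ∫ y, f y ∂(M.Pkπ n π x) := by
  rw [integral_Pkπ n π hf, Tk]
  simp only [hπ.integral_eq_iSup hf.measurable]

variable [Nonempty A]

lemma rk_add_le_Tk (n : ℕ) (π : Policy S A) (hf : BddMeasurable f) (x : S × A) :
    M.rk n x + M.γ ^ n * ∫ y, f y ∂(M.Pkπ n π x) ≤ M.Tk n f x := by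
  have := M.γ_nonneg
  rw [integral_Pkπ n π hf, Tk]
  gcongr
  · exact (hf.integral_kernel_prodMk π.kernel).integrable _
  · exact hf.iSup_snd.integrable _
  · exact fun s => π.integral_le_iSup hf s

lemma bddMeasurable_Tk (hR : ∀ x, |M.r x| ≤ Rmax) (n : ℕ) (hf : BddMeasurable f) :
    BddMeasurable (M.Tk n f) :=
  (bddMeasurable_rk hR n).add ((hf.iSup_snd.integral_kernel _).const_mul _)

lemma Tk_sub_Tk_le (n : ℕ) {π : Policy S A} (hf : BddMeasurable f) (hg : BddMeasurable g)
    (hπ : π.IsGreedy f) (x : S × A) :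
    M.Tk n f x - M.Tk n g x ≤ M.γ ^ n * ∫ y, (f y - g y) ∂(M.Pkπ n π x) := by
  rw [Tk_eq_of_isGreedy n hf hπ, integral_sub (hf.integrable _) (hg.integrable _)]
  linarith [rk_add_le_Tk (M := M) n π hg x]

lemma abs_Tk_sub_Tk_le (n : ℕ) (hf : BddMeasurable f) (hg : BddMeasurable g) {C : ℝ}
    (h : ∀ x, |f x - g x| ≤ C) (x : S × A) : |M.Tk n f x - M.Tk n g x| ≤ M.γ ^ n * C := by
  obtain ⟨π, hπ⟩ := Policy.exists_isGreedy hf.measurable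
  obtain ⟨σ, hσ⟩ := Policy.exists_isGreedy hg.measurable
  have hγ := pow_nonneg M.γ_nonneg n
  have h' (x : S × A) : |g x - f x| ≤ C := abs_sub_comm (f x) (g x) ▸ h x
  refine abs_sub_le_iff.2 ⟨(Tk_sub_Tk_le n hf hg hπ x).trans ?_,
    (Tk_sub_Tk_le n hg hf hσ x).trans ?_⟩
  · exact mul_le_mul_of_nonneg_left (le_of_abs_le (abs_integral_le_of_abs_le h _)) hγ
  · exact mul_le_mul_of_nonneg_left (le_of_abs_le (abs_integral_le_of_abs_le h' _)) hγ

lemma exists_fixedPoint_Tk (hR : ∀ x, |M.r x| ≤ Rmax) {k : ℕ} (hk : 1 ≤ k) :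
    ∃ W : S × A → ℝ, BddMeasurable W ∧ M.Tk k W = W :=
  BddMeasurable.exists_fixedPoint (pow_nonneg M.γ_nonneg k) (γ_pow_lt_one hk)
    (fun _ hf => bddMeasurable_Tk hR k hf) fun _ _ hf hg _ h x => abs_Tk_sub_Tk_le k hf hg h x

lemma Qπ_le_fixedPoint (hR : ∀ x, |M.r x| ≤ Rmax) {k : ℕ} (hk : 1 ≤ k) {W : S × A → ℝ}
    (hW : BddMeasurable W) (hfix : M.Tk k W = W) (π : Policy S A) (x : S × A) :
    M.Qπ k π x ≤ W x := by
  have hQ := bddMeasurable_Qπ hR k π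
  refine sub_nonpos.1 (nonpos_of_le_mul_integral (M.Pkπ k π) (pow_nonneg M.γ_nonneg k)
    (γ_pow_lt_one hk) (hQ.sub hW) (fun x => ?_) x)
  rw [Qπ_eq_rk_add hR hk, integral_sub (hQ.integrable _) (hW.integrable _)]
  linarith [congrFun hfix x, rk_add_le_Tk (M := M) k π hW x]

lemma Qπ_eq_fixedPoint (hR : ∀ x, |M.r x| ≤ Rmax) {k : ℕ} (hk : 1 ≤ k) {W : S × A → ℝ}
    (hW : BddMeasurable W) (hfix : M.Tk k W = W) {π : Policy S A} (hπ : π.IsGreedy W)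
    (x : S × A) : M.Qπ k π x = W x := by
  have hQ := bddMeasurable_Qπ hR k π
  refine le_antisymm (Qπ_le_fixedPoint hR hk hW hfix π x) (sub_nonpos.1
    (nonpos_of_le_mul_integral (M.Pkπ k π) (pow_nonneg M.γ_nonneg k) (γ_pow_lt_one hk)
      (hW.sub hQ) (fun x => ?_) x))
  rw [Qπ_eq_rk_add hR hk, integral_sub (hW.integrable _) (hQ.integrable _)]
  linarith [congrFun hfix x, Tk_eq_of_isGreedy (M := M) k hW hπ x]

lemma Qopt_eq_fixedPoint (hR : ∀ x, |M.r x| ≤ Rmax) {k : ℕ} (hk : 1 ≤ k) {W : S × A → ℝ}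
    (hW : BddMeasurable W) (hfix : M.Tk k W = W) : M.Qopt k = W := by
  obtain ⟨π, hπ⟩ := Policy.exists_isGreedy hW.measurable
  have hle (x : S × A) (σ : Policy S A) := Qπ_le_fixedPoint hR hk hW hfix σ x
  have : Nonempty (Policy S A) := ⟨π⟩
  ext x
  refine le_antisymm (ciSup_le (hle x)) ?_
  rw [← Qπ_eq_fixedPoint hR hk hW hfix hπ x]
  exact le_ciSup (f := fun σ => M.Qπ k σ x) ⟨W x, Set.forall_mem_range.2 (hle x)⟩ π

lemma bddMeasurable_Qopt (hR : ∀ x, |M.r x| ≤ Rmax) {k : ℕ} (hk : 1 ≤ k) :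
    BddMeasurable (M.Qopt k) := by
  obtain ⟨W, hW, hfix⟩ := exists_fixedPoint_Tk hR hk
  rwa [Qopt_eq_fixedPoint hR hk hW hfix]

lemma Tk_Qopt (hR : ∀ x, |M.r x| ≤ Rmax) {k : ℕ} (hk : 1 ≤ k) :
    M.Tk k (M.Qopt k) = M.Qopt k := by
  obtain ⟨W, hW, hfix⟩ := exists_fixedPoint_Tk hR hk
  rw [Qopt_eq_fixedPoint hR hk hW hfix, hfix]

lemma Qπ_le_Qopt (hR : ∀ x, |M.r x| ≤ Rmax) {k : ℕ} (hk : 1 ≤ k) (π : Policy S A) (x : S × A) :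
    M.Qπ k π x ≤ M.Qopt k x :=
  Qπ_le_fixedPoint hR hk (bddMeasurable_Qopt hR hk) (Tk_Qopt hR hk) π x

lemma abs_Qopt_le (hR : ∀ x, |M.r x| ≤ Rmax) {k : ℕ} (hk : 1 ≤ k) (x : S × A) :
    |M.Qopt k x| ≤ Rmax / (1 - M.γ) := by
  have hQ := bddMeasurable_Qopt hR hk
  obtain ⟨π, hπ⟩ := Policy.exists_isGreedy hQ.measurable
  rw [← Qπ_eq_fixedPoint hR hk hQ (Tk_Qopt hR hk) hπ x]
  exact abs_Qπ_le hR k π x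

end Optimality

section PersistentBackup

/-- The operator applied by persistent value iteration at step `j`. -/
def pviOp (k j : ℕ) (f : S × A → ℝ) : S × A → ℝ :=
  if j % k = 0 then M.Topt f else M.Tδ f

/-- Persistent value iteration started at `f` and carried out without errors. -/
def pviIter (k : ℕ) (f : S × A → ℝ) : ℕ → S × A → ℝ
  | 0 => f
  | j + 1 => M.pviOp k j (pviIter k f j)

variable {M} {Rmax : ℝ} {f g : S × A → ℝ}

lemma err_eq (k : ℕ) (Q : ℕ → S × A → ℝ) (j : ℕ) (x : S × A) :
    M.err k Q j x = M.pviOp k j (Q j) x - Q (j + 1) x := by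
  rw [err, pviOp]
  split_ifs <;> rfl

lemma pviIter_mul_add {k l : ℕ} (f : S × A → ℝ) (n : ℕ) (hl : l < k) :
    M.pviIter k f (k * n + (l + 1)) = M.Tδ^[l] (M.Topt (M.pviIter k f (k * n))) := by
  induction l with
  | zero =>
    rw [zero_add, pviIter, pviOp, if_pos (Nat.mul_mod_right k n), Function.iterate_zero_apply]
  | succ l ih =>
    have hmod : (k * n + (l + 1)) % k ≠ 0 := by
      rw [Nat.mul_add_mod, Nat.mod_eq_of_lt hl]; omega
    rw [← add_assoc, pviIter, pviOp, if_neg hmod, ih (by omega), Function.iterate_succ_apply']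

lemma rk_succ (n : ℕ) (x : S × A) :
    M.rk (n + 1) x = M.rk n x + M.γ ^ n * ∫ y, M.r y ∂((M.Pδ ^ n) x) :=
  Finset.sum_range_succ _ n

lemma bddMeasurable_Tδ (hR : ∀ x, |M.r x| ≤ Rmax) (hf : BddMeasurable f) :
    BddMeasurable (M.Tδ f) :=
  (bddMeasurable_r hR).add ((hf.integral_kernel M.Pδ).const_mul _)

lemma iterate_Tδ_apply (hR : ∀ x, |M.r x| ≤ Rmax) (hf : BddMeasurable f) (n : ℕ) (x : S × A) :
    (M.Tδ^[n] f) x = M.rk n x + M.γ ^ n * ∫ y, f y ∂((M.Pδ ^ n) x) := by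
  have hr := bddMeasurable_r hR
  induction n generalizing f with
  | zero =>
    have hid : (M.Pδ ^ 0) x = Measure.dirac x := Kernel.id_apply x
    rw [hid, integral_dirac' _ _ hf.measurable.stronglyMeasurable]
    simp [rk]
  | succ n ih =>
    rw [Function.iterate_succ_apply, ih (bddMeasurable_Tδ hR hf), rk_succ, kernel_pow_succ',
      Kernel.integral_comp (hf.integrable _)]
    simp only [Tδ]
    rw [integral_add (hr.integrable _) (((hf.integral_kernel _).const_mul _).integrable _),
      integral_const_mul]
    ring

variable [Finite A] [Nonempty A]

lemma bddMeasurable_Topt (hR : ∀ x, |M.r x| ≤ Rmax) (hf : BddMeasurable f) :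
    BddMeasurable (M.Topt f) :=
  (bddMeasurable_r hR).add ((hf.iSup_snd.integral_kernel M.P).const_mul _)

lemma Tk_succ (hR : ∀ x, |M.r x| ≤ Rmax) (hf : BddMeasurable f) (n : ℕ) :
    M.Tk (n + 1) f = M.Tδ^[n] (M.Topt f) := by
  ext x
  have hr := bddMeasurable_r hR
  rw [iterate_Tδ_apply hR (bddMeasurable_Topt hR hf), Tk, rk_succ, Pk, Nat.add_sub_cancel,
    Kernel.integral_comp (hf.iSup_snd.integrable _)]
  simp only [Topt]
  rw [integral_add (hr.integrable _) (((hf.iSup_snd.integral_kernel _).const_mul _).integrable _),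
    integral_const_mul]
  ring

lemma Topt_sub_Topt_le (hR : ∀ x, |M.r x| ≤ Rmax) {π : Policy S A} (hf : BddMeasurable f)
    (hg : BddMeasurable g) (hπ : π.IsGreedy f) (x : S × A) :
    M.Topt f x - M.Topt g x ≤ M.γ * ∫ y, (f y - g y) ∂(M.Pkπ 1 π x) := by
  simpa [Tk_succ hR hf 0, Tk_succ hR hg 0] using Tk_sub_Tk_le (M := M) 1 hf hg hπ x

lemma bddMeasurable_pviOp (hR : ∀ x, |M.r x| ≤ Rmax) (k j : ℕ) (hf : BddMeasurable f) :
    BddMeasurable (M.pviOp k j f) := by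
  unfold pviOp
  split_ifs
  exacts [bddMeasurable_Topt hR hf, bddMeasurable_Tδ hR hf]

lemma pviOp_sub_pviOp_le (hR : ∀ x, |M.r x| ≤ Rmax) {k j : ℕ} {π : Policy S A}
    (hf : BddMeasurable f) (hg : BddMeasurable g) (hπ : j % k = 0 → π.IsGreedy f) (x : S × A) :
    M.pviOp k j f x - M.pviOp k j g x ≤
      M.γ * ∫ y, (f y - g y) ∂(M.stepKernel k π j x) := by
  unfold pviOp stepKernel
  split_ifs with hj
  · exact Topt_sub_Topt_le hR hf hg (hπ hj) x
  · rw [Tδ, Tδ, integral_sub (hf.integrable _) (hg.integrable _)]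
    exact le_of_eq (by ring)

lemma bddMeasurable_pviIter (hR : ∀ x, |M.r x| ≤ Rmax) (k : ℕ) (hf : BddMeasurable f) (j : ℕ) :
    BddMeasurable (M.pviIter k f j) := by
  induction j with
  | zero => exact hf
  | succ j ih => exact bddMeasurable_pviOp hR k j ih

lemma pviIter_Qopt_mul (hR : ∀ x, |M.r x| ≤ Rmax) {k : ℕ} (hk : 1 ≤ k) (n : ℕ) :
    M.pviIter k (M.Qopt k) (k * n) = M.Qopt k := by
  induction n with
  | zero => rfl
  | succ n ih =>
    obtain ⟨m, rfl⟩ := Nat.exists_eq_add_of_le' hk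
    rw [mul_add_one, pviIter_mul_add _ n m.lt_succ_self, ih,
      ← Tk_succ hR (bddMeasurable_Qopt hR hk), Tk_Qopt hR hk]

end PersistentBackup

end MDP

section Unrolling

variable {X : Type*} [MeasurableSpace X]

lemma ofReal_integral_le_lintegral_ofReal {μ : Measure X} {f : X → ℝ} (hf : Integrable f μ) :
    ENNReal.ofReal (∫ x, f x ∂μ) ≤ ∫⁻ x, ENNReal.ofReal (f x) ∂μ := by
  rw [integral_eq_lintegral_pos_part_sub_lintegral_neg_part hf]
  exact (ENNReal.ofReal_le_ofReal (sub_le_self _ ENNReal.toReal_nonneg)).trans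
    ENNReal.ofReal_toReal_le

lemma lintegral_sum_lintegral_add_const {Y Z ι : Type*} [MeasurableSpace Y] [MeasurableSpace Z]
    (s : Finset ι) (a : ι → ℝ≥0∞) {E : ι → Z → ℝ≥0∞} (hE : ∀ i ∈ s, Measurable (E i))
    (K : ι → Kernel Y Z) (κ : Kernel X Y) [IsMarkovKernel κ] (c : ℝ≥0∞) (x : X) :
    ∫⁻ y, ∑ i ∈ s, a i * ∫⁻ z, E i z ∂(K i y) + c ∂(κ x) =
      ∑ i ∈ s, a i * ∫⁻ z, E i z ∂((K i ∘ₖ κ) x) + c := by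
  rw [lintegral_add_right _ measurable_const, lintegral_const, measure_univ, mul_one,
    lintegral_finsetSum' _ fun i hi => ((hE i hi).lintegral_kernel.const_mul _).aemeasurable]
  congr 1
  refine Finset.sum_congr rfl fun i hi => ?_
  rw [lintegral_const_mul _ (hE i hi).lintegral_kernel, Kernel.lintegral_comp _ _ _ (hE i hi)]

/-- The backward product `κ (c + n), …, κ (c + 1)` of a sequence of kernels, the kernel
`κ (c + n)` acting first: it transports an error made at time `c` to time `c + n`. -/
def backProd (κ : ℕ → Kernel X X) (c : ℕ) : ℕ → Kernel X X
  | 0 => Kernel.id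
  | n + 1 => backProd κ c n ∘ₖ κ (c + (n + 1))

instance isMarkovKernel_backProd (κ : ℕ → Kernel X X) [∀ n, IsMarkovKernel (κ n)] (c n : ℕ) :
    IsMarkovKernel (backProd κ c n) := by
  induction n with
  | zero => unfold backProd; infer_instance
  | succ n ih => unfold backProd; infer_instance

lemma backProd_one (κ : ℕ → Kernel X X) (c : ℕ) : backProd κ c 1 = κ (c + 1) :=
  Kernel.id_comp _

lemma backProd_add (κ : ℕ → Kernel X X) (c m n : ℕ) :
    backProd κ c (m + n) = backProd κ c m ∘ₖ backProd κ (c + m) n := by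
  induction n with
  | zero => exact (Kernel.comp_id _).symm
  | succ n ih =>
    rw [← add_assoc, backProd, ih, backProd, Kernel.comp_assoc, add_assoc m, add_assoc c]

lemma backProd_eq_pow {κ : ℕ → Kernel X X} {η : Kernel X X} {c n : ℕ}
    (h : ∀ i < n, κ (c + (i + 1)) = η) : backProd κ c n = η ^ n := by
  induction n with
  | zero => rfl
  | succ n ih => rw [backProd, ih fun i hi => h i (hi.trans n.lt_succ_self), h n n.lt_succ_self,
      pow_succ]; rfl

lemma le_sum_backProd (κ : ℕ → Kernel X X) [∀ n, IsMarkovKernel (κ n)] {a c₀ : ℝ≥0∞}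
    {Y E : ℕ → X → ℝ≥0∞} {n : ℕ} (hE : ∀ j < n, Measurable (E j)) (h0 : ∀ x, Y 0 x ≤ c₀)
    (hY : ∀ j < n, ∀ x, Y (j + 1) x ≤ a * ∫⁻ y, Y j y ∂(κ j x) + E j x) (x : X) :
    Y n x ≤ ∑ j ∈ Finset.range n,
      a ^ (n - j - 1) * ∫⁻ y, E j y ∂(backProd κ j (n - j - 1) x) + a ^ n * c₀ := by
  induction n generalizing x with
  | zero => simpa using h0 x
  | succ n ih =>
    have hE' : ∀ j ∈ Finset.range n, Measurable (E j) :=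
      fun j hj => hE j ((Finset.mem_range.1 hj).trans n.lt_succ_self)
    have hlast : E n x = ∫⁻ y, E n y ∂(backProd κ n 0 x) :=
      (lintegral_dirac' _ (hE n n.lt_succ_self)).symm
    have hstep (j : ℕ) (hj : j ∈ Finset.range n) :
        a * (a ^ (n - j - 1) * ∫⁻ y, E j y ∂((backProd κ j (n - j - 1) ∘ₖ κ n) x)) =
          a ^ (n + 1 - j - 1) * ∫⁻ y, E j y ∂(backProd κ j (n + 1 - j - 1) x) := by
      have hjn := Finset.mem_range.1 hj
      rw [← mul_assoc, ← pow_succ', show n + 1 - j - 1 = n - j - 1 + 1 by lia, backProd,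
        show j + (n - j - 1 + 1) = n by lia]
    calc Y (n + 1) x ≤ a * ∫⁻ y, Y n y ∂(κ n x) + E n x := hY n n.lt_succ_self x
      _ ≤ a * ∫⁻ y, (∑ j ∈ Finset.range n, a ^ (n - j - 1) *
            ∫⁻ z, E j z ∂(backProd κ j (n - j - 1) y) + a ^ n * c₀) ∂(κ n x) + E n x := by
          gcongr with y
          exact ih (fun j hj => hE j (by lia)) (fun j hj => hY j (by lia)) y
      _ = ∑ j ∈ Finset.range n, a ^ (n + 1 - j - 1) *
            ∫⁻ y, E j y ∂(backProd κ j (n + 1 - j - 1) x) + a ^ (n + 1) * c₀ + E n x := by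
          rw [lintegral_sum_lintegral_add_const _ _ hE', mul_add, Finset.mul_sum,
            Finset.sum_congr rfl hstep, ← mul_assoc, ← pow_succ']
      _ = _ := by
          rw [Finset.sum_range_succ, hlast, add_right_comm]
          simp

lemma le_tsum_lintegral_pow (κ : Kernel X X) [IsMarkovKernel κ] {a C : ℝ≥0∞} (ha : a < 1)
    (hC : C ≠ ⊤) {Y H : X → ℝ≥0∞} (hH : Measurable H) (hYC : ∀ x, Y x ≤ C)
    (hY : ∀ x, Y x ≤ a * ∫⁻ y, Y y ∂(κ x) + H x) (x : X) :
    Y x ≤ ∑' m : ℕ, a ^ m * ∫⁻ y, H y ∂((κ ^ m) x) := by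
  have hfinite (n : ℕ) : Y x ≤ ∑' m : ℕ, a ^ m * ∫⁻ y, H y ∂((κ ^ m) x) + a ^ n * C := by
    refine (le_sum_backProd (fun _ => κ) (n := n) (fun _ _ => hH) hYC (fun _ _ => hY) x).trans ?_
    have hpow (j m : ℕ) : backProd (fun _ => κ) j m = κ ^ m := backProd_eq_pow fun _ _ => rfl
    simp only [hpow, Nat.sub_right_comm _ _ 1]
    rw [Finset.sum_range_reflect (fun m => a ^ m * ∫⁻ y, H y ∂((κ ^ m) x)) n]
    gcongr
    exact ENNReal.sum_le_tsum _
  have hvanish : Tendsto (fun n : ℕ => a ^ n * C) atTop (𝓝 0) := by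
    simpa using ENNReal.Tendsto.mul_const (ENNReal.tendsto_pow_atTop_nhds_zero_of_lt_one ha)
      (b := C) (Or.inr hC)
  have hlim := hvanish.const_add (∑' m : ℕ, a ^ m * ∫⁻ y, H y ∂((κ ^ m) x))
  rw [add_zero] at hlim
  exact ge_of_tendsto' hlim hfinite

end Unrolling

namespace MDP

variable {S A : Type*} [MeasurableSpace S] [MeasurableSpace A] (M : MDP S A)

lemma chain_eq_bind_backProd (k c : ℕ) (π : ℕ → Policy S A) (n : ℕ) (μ : Measure (S × A)) :
    M.chain k (fun l => π (k * (c + l))) n μ =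
      μ.bind (backProd (fun d => M.Pkπ k (π (k * d))) c n) := by
  induction n generalizing μ with
  | zero => exact (Measure.bind_dirac (m := μ)).symm
  | succ n ih => rw [chain, ih, backProd, Measure.comp_assoc]

lemma backProd_stepKernel_sub_one {k : ℕ} (hk : 1 ≤ k) (π : ℕ → Policy S A) {d : ℕ} (hd : 1 ≤ d) :
    backProd (fun i => M.stepKernel k (π i) i) (k * d - 1) k = M.Pkπ k (π (k * d)) := by
  have hkd : k * d - 1 + 1 = k * d := Nat.sub_add_cancel (Nat.mul_pos hk hd)
  have hfresh : M.stepKernel k (π (k * d)) (k * d) = M.Pkπ 1 (π (k * d)) :=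
    if_pos (Nat.mul_mod_right k d)
  have hrepeat : ∀ i < k - 1,
      M.stepKernel k (π (k * d + (i + 1))) (k * d + (i + 1)) = M.Pδ := fun i hi => by
    rw [stepKernel, if_neg (by rw [Nat.mul_add_mod, Nat.mod_eq_of_lt (by lia)]; lia)]
  obtain ⟨n, rfl⟩ : ∃ n, k = 1 + n := ⟨k - 1, by lia⟩
  rw [backProd_add, backProd_one, hkd, backProd_eq_pow fun i hi => hrepeat i (by lia), hfresh,
    ← Pkπ_one_comp _ (1 + n), Nat.add_sub_cancel_left]

lemma backProd_stepKernel_add_mul {k : ℕ} (π : ℕ → Policy S A) {l : ℕ} (hl : l < k) (c n : ℕ) :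
    backProd (fun i => M.stepKernel k (π i) i) (k * c + l) (k - l - 1 + k * n) =
      (M.Pδ ^ (k - l - 1)) ∘ₖ backProd (fun d => M.Pkπ k (π (k * d))) c n := by
  induction n with
  | zero =>
    rw [mul_zero, add_zero, backProd, Kernel.comp_id]
    refine backProd_eq_pow fun i hi => ?_
    rw [stepKernel, if_neg (by rw [add_assoc, Nat.mul_add_mod, Nat.mod_eq_of_lt (by lia)]; lia)]
  | succ n ih =>
    have hstart : k * c + l + (k - l - 1 + k * n) = k * (c + (n + 1)) - 1 := by
      rw [mul_add, mul_add]; lia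
    rw [mul_add, mul_one, ← add_assoc, backProd_add, ih, hstart,
      backProd_stepKernel_sub_one M (by lia) π (by lia), Kernel.comp_assoc, backProd]

lemma backProd_stepKernel {k J j : ℕ} (hk : 1 ≤ k) (hkJ : k ∣ J) (hj : j < J)
    (π : ℕ → Policy S A) :
    backProd (fun i => M.stepKernel k (π i) i) j (J - j - 1) =
      (M.Pδ ^ (k - j % k - 1)) ∘ₖ
        backProd (fun d => M.Pkπ k (π (k * d))) (j / k) (J / k - j / k - 1) := by
  obtain ⟨D, rfl⟩ := hkJ
  have hl : j % k < k := Nat.mod_lt j hk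
  have hc : j / k < D := Nat.div_lt_of_lt_mul hj
  have hlength : k * D - j - 1 = k - j % k - 1 + k * (k * D / k - j / k - 1) := by
    obtain ⟨n, rfl⟩ : ∃ n, D = j / k + 1 + n := ⟨D - (j / k + 1), by lia⟩
    rw [Nat.mul_div_cancel_left _ hk, show j / k + 1 + n - j / k - 1 = n by lia, mul_add, mul_add]
    have := Nat.div_add_mod j k
    lia
  rw [hlength, ← backProd_stepKernel_add_mul M π hl, Nat.div_add_mod]

section ErrorKernels

/-- The kernel of `ρ ↦ ρ (P_k^π)^m₁ (P_k^{π*})^m₂ (P^δ)^m₃`, whose density norm is the coefficient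
`c₁`: it transports the error of an iterate along the optimal policy. -/
def errKernel₁ (k : ℕ) (πstar : Policy S A) (m₁ m₂ m₃ : ℕ) (π : Policy S A) :
    Kernel (S × A) (S × A) :=
  ((M.Pδ ^ m₃) ∘ₖ (M.Pkπ k πstar ^ m₂)) ∘ₖ (M.Pkπ k π ^ m₁)

/-- The kernel whose density norm is the coefficient `c₂` of the policies
`π (k (c + 1)), …, π (k (c + L))`: it transports the error of an iterate along the policies that
are greedy with respect to the later iterates. -/
def errKernel₂ (k m₁ m₂ c L : ℕ) (π : ℕ → Policy S A) : Kernel (S × A) (S × A) :=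
  ((M.Pδ ^ m₂) ∘ₖ backProd (fun d => M.Pkπ k (π (k * d))) c (L - 1)) ∘ₖ
    (M.Pkπ k (π (k * (c + L))) ^ m₁)

instance isMarkovKernel_errKernel₁ (k : ℕ) (πstar : Policy S A) (m₁ m₂ m₃ : ℕ)
    (π : Policy S A) : IsMarkovKernel (M.errKernel₁ k πstar m₁ m₂ m₃ π) := by
  unfold errKernel₁; infer_instance

instance isMarkovKernel_errKernel₂ (k m₁ m₂ c L : ℕ) (π : ℕ → Policy S A) :
    IsMarkovKernel (M.errKernel₂ k m₁ m₂ c L π) := by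
  unfold errKernel₂; infer_instance

lemma cVI₁_eq_densityNorm (k : ℕ) (q : ℝ≥0∞) (ρ ν : Measure (S × A)) (πstar : Policy S A)
    (m₁ m₂ m₃ : ℕ) (π : Policy S A) :
    M.cVI₁ k q ρ ν πstar m₁ m₂ m₃ π =
      densityNorm q (ρ.bind (M.errKernel₁ k πstar m₁ m₂ m₃ π)) ν := by
  rw [cVI₁, errKernel₁, Measure.comp_assoc, Measure.comp_assoc, Kernel.comp_assoc]

lemma cVI₂_eq_densityNorm (k : ℕ) (q : ℝ≥0∞) (ρ ν : Measure (S × A)) (m₁ m₂ c L : ℕ)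
    (π : ℕ → Policy S A) :
    M.cVI₂ k q ρ ν m₁ m₂ L (fun l => π (k * (c + l))) =
      densityNorm q (ρ.bind (M.errKernel₂ k m₁ m₂ c L π)) ν := by
  rw [cVI₂, errKernel₂, chain_eq_bind_backProd, Measure.comp_assoc, Measure.comp_assoc,
    Kernel.comp_assoc]

end ErrorKernels

section ErrorPropagation

variable {M}
variable [Finite A] [Nonempty A] {Rmax : ℝ} {k J : ℕ} {Q : ℕ → S × A → ℝ}
  {πstar : Policy S A}

lemma bddMeasurable_err (hR : ∀ x, |M.r x| ≤ Rmax) (hQ : ∀ j ≤ J, BddMeasurable (Q j)) {j : ℕ}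
    (hj : j < J) : BddMeasurable (M.err k Q j) := by
  simpa only [← err_eq] using (bddMeasurable_pviOp hR k j (hQ j hj.le)).sub (hQ (j + 1) hj)

lemma lintegral_ofReal_iterate_sub_le (hR : ∀ x, |M.r x| ≤ Rmax) (hk : 1 ≤ k) (hkJ : k ∣ J)
    {F G e : ℕ → S × A → ℝ} (hF : ∀ j < J, BddMeasurable (F j))
    (hG : ∀ j < J, BddMeasurable (G j)) (he : ∀ j < J, Measurable (e j)) {π : ℕ → Policy S A}
    (hπ : ∀ j < J, j % k = 0 → (π j).IsGreedy (F j))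
    (hFG : ∀ j < J, ∀ x,
      F (j + 1) x - G (j + 1) x ≤ M.pviOp k j (F j) x - M.pviOp k j (G j) x + |e j x|)
    {c₀ : ℝ} (h0 : ∀ x, F 0 x - G 0 x ≤ c₀) {X : Type*} [MeasurableSpace X]
    (κ : Kernel X (S × A)) [IsMarkovKernel κ] (x : X) :
    ∫⁻ y, ENNReal.ofReal (F J y - G J y) ∂(κ x) ≤
      ∑ j ∈ Finset.range J, ENNReal.ofReal M.γ ^ (J - j - 1) * ∫⁻ y, ‖e j y‖ₑ
        ∂((((M.Pδ ^ (k - j % k - 1)) ∘ₖ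
          backProd (fun d => M.Pkπ k (π (k * d))) (j / k) (J / k - j / k - 1)) ∘ₖ κ) x) +
      ENNReal.ofReal M.γ ^ J * ENNReal.ofReal c₀ := by
  have hstep (j : ℕ) (hj : j < J) (x : S × A) :
      ENNReal.ofReal (F (j + 1) x - G (j + 1) x) ≤ ENNReal.ofReal M.γ *
        ∫⁻ y, ENNReal.ofReal (F j y - G j y) ∂(M.stepKernel k (π j) j x) + ‖e j x‖ₑ := by
    have hop := pviOp_sub_pviOp_le hR (hF j hj) (hG j hj) (hπ j hj) x
    refine (ENNReal.ofReal_le_ofReal ((hFG j hj x).trans (add_le_add hop le_rfl))).trans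
      (ENNReal.ofReal_add_le.trans ?_)
    rw [ENNReal.ofReal_mul M.γ_nonneg, Real.enorm_eq_ofReal_abs]
    gcongr
    exact ofReal_integral_le_lintegral_ofReal (((hF j hj).sub (hG j hj)).integrable _)
  have hunroll := le_sum_backProd (fun j => M.stepKernel k (π j) j) (n := J)
    (Y := fun j y => ENNReal.ofReal (F j y - G j y)) (E := fun j y => ‖e j y‖ₑ)
    (fun j hj => (he j hj).enorm) (fun x => ENNReal.ofReal_le_ofReal (h0 x)) hstep
  refine (lintegral_mono hunroll).trans_eq ?_
  rw [lintegral_sum_lintegral_add_const _ _ fun j hj => (he j (Finset.mem_range.1 hj)).enorm]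
  congr 1
  refine Finset.sum_congr rfl fun j hj => ?_
  rw [backProd_stepKernel M hk hkJ (Finset.mem_range.1 hj)]

lemma lintegral_ofReal_Qopt_sub_le (hR : ∀ x, |M.r x| ≤ Rmax) (hk : 1 ≤ k) (hkJ : k ∣ J)
    (hπstar : πstar.IsGreedy (M.Qopt k)) (hQ : ∀ j ≤ J, BddMeasurable (Q j)) {c₀ : ℝ}
    (h0 : ∀ x, |M.Qopt k x - Q 0 x| ≤ c₀) (π : Policy S A) (m : ℕ) (x : S × A) :
    ∫⁻ y, ENNReal.ofReal (M.Qopt k y - Q J y) ∂((M.Pkπ k πstar ∘ₖ (M.Pkπ k π ^ m)) x) ≤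
      ∑ j ∈ Finset.range J, ENNReal.ofReal M.γ ^ (J - j - 1) * ∫⁻ y, ‖M.err k Q j y‖ₑ
        ∂(M.errKernel₁ k πstar m (J / k - j / k) (k - j % k - 1) π x) +
      ENNReal.ofReal M.γ ^ J * ENNReal.ofReal c₀ := by
  have hopt {j : ℕ} (hj : j % k = 0) : M.pviIter k (M.Qopt k) j = M.Qopt k := by
    rw [← Nat.mul_div_cancel' (Nat.dvd_of_mod_eq_zero hj), pviIter_Qopt_mul hR hk]
  have hbound := lintegral_ofReal_iterate_sub_le hR hk hkJ (F := M.pviIter k (M.Qopt k)) (G := Q)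
    (fun j _ => bddMeasurable_pviIter hR k (bddMeasurable_Qopt hR hk) j) (fun j hj => hQ j hj.le)
    (fun j hj => (bddMeasurable_err hR hQ hj).measurable) (π := fun _ => πstar)
    (fun j _ hjk => by rwa [hopt hjk])
    (fun j _ x => by
      have h := le_abs_self (M.err k Q j x)
      rw [err_eq] at h ⊢
      rw [pviIter]
      linarith)
    (fun x => (le_abs_self _).trans (h0 x)) (M.Pkπ k πstar ∘ₖ (M.Pkπ k π ^ m)) x
  rw [hopt (Nat.mod_eq_zero_of_dvd hkJ)] at hbound
  refine hbound.trans_eq ?_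
  congr 1
  refine Finset.sum_congr rfl fun j hj => ?_
  have hjJ : j / k < J / k := Nat.div_lt_div_of_lt_of_dvd hkJ (Finset.mem_range.1 hj)
  obtain ⟨n, hn⟩ : ∃ n, J / k - j / k = n + 1 := ⟨J / k - j / k - 1, by lia⟩
  rw [backProd_eq_pow fun _ _ => rfl, hn, Nat.add_sub_cancel, errKernel₁, pow_succ,
    Kernel.comp_assoc, Kernel.comp_assoc, ← Kernel.comp_assoc (M.Pkπ k πstar ^ n)]
  rfl

lemma lintegral_ofReal_sub_Qopt_le (hR : ∀ x, |M.r x| ≤ Rmax) (hk : 1 ≤ k) (hkJ : k ∣ J)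
    (hQ : ∀ j ≤ J, BddMeasurable (Q j)) {c₀ : ℝ} (h0 : ∀ x, |M.Qopt k x - Q 0 x| ≤ c₀)
    {π : ℕ → Policy S A} (hπ : ∀ j < J, j % k = 0 → (π j).IsGreedy (Q j)) (m : ℕ) (x : S × A) :
    ∫⁻ y, ENNReal.ofReal (Q J y - M.Qopt k y) ∂((M.Pkπ k (π J) ^ m) x) ≤
      ∑ j ∈ Finset.range J, ENNReal.ofReal M.γ ^ (J - j - 1) * ∫⁻ y, ‖M.err k Q j y‖ₑ
        ∂(M.errKernel₂ k m (k - j % k - 1) (j / k) (J / k - j / k) π x) +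
      ENNReal.ofReal M.γ ^ J * ENNReal.ofReal c₀ := by
  have hopt : M.pviIter k (M.Qopt k) J = M.Qopt k := by
    rw [← Nat.mul_div_cancel' hkJ, pviIter_Qopt_mul hR hk]
  have hbound := lintegral_ofReal_iterate_sub_le hR hk hkJ (F := Q) (G := M.pviIter k (M.Qopt k))
    (fun j hj => hQ j hj.le) (fun j _ => bddMeasurable_pviIter hR k (bddMeasurable_Qopt hR hk) j)
    (fun j hj => (bddMeasurable_err hR hQ hj).measurable) hπ
    (fun j _ x => by
      have h := neg_abs_le (M.err k Q j x)
      rw [err_eq] at h ⊢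
      rw [pviIter]
      linarith)
    (fun x => (le_abs_self _).trans (abs_sub_comm (Q 0 x) _ ▸ h0 x)) (M.Pkπ k (π J) ^ m) x
  rw [hopt] at hbound
  refine hbound.trans_eq ?_
  congr 1
  refine Finset.sum_congr rfl fun j hj => ?_
  have hjJ : j / k ≤ J / k := Nat.div_le_div_right (Finset.mem_range.1 hj).le
  rw [errKernel₂, Nat.add_sub_cancel' hjJ, Nat.mul_div_cancel' hkJ]

lemma Qopt_sub_Qπ_le (hR : ∀ x, |M.r x| ≤ Rmax) (hk : 1 ≤ k)
    (hπstar : πstar.IsGreedy (M.Qopt k)) {f : S × A → ℝ} (hf : BddMeasurable f)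
    {π : Policy S A} (hπ : π.IsGreedy f) (x : S × A) :
    M.Qopt k x - M.Qπ k π x ≤ M.γ ^ k * (∫ y, (M.Qopt k y - M.Qπ k π y) ∂(M.Pkπ k π x) +
      (∫ y, (M.Qopt k y - f y) ∂(M.Pkπ k πstar x) +
        ∫ y, (f y - M.Qopt k y) ∂(M.Pkπ k π x))) := by
  have hopt := bddMeasurable_Qopt hR hk
  have hval := bddMeasurable_Qπ hR k π
  have hQopt : M.Qopt k x = M.rk k x + M.γ ^ k * ∫ y, M.Qopt k y ∂(M.Pkπ k πstar x) := by
    rw [← Tk_eq_of_isGreedy k hopt hπstar, Tk_Qopt hR hk]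
  have hgreedy : M.rk k x + M.γ ^ k * ∫ y, f y ∂(M.Pkπ k πstar x) ≤
      M.rk k x + M.γ ^ k * ∫ y, f y ∂(M.Pkπ k π x) :=
    (rk_add_le_Tk k πstar hf x).trans_eq (Tk_eq_of_isGreedy k hf hπ x)
  rw [Qπ_eq_rk_add hR hk, hQopt, integral_sub (hopt.integrable _) (hval.integrable _),
    integral_sub (hopt.integrable _) (hf.integrable _),
    integral_sub (hf.integrable _) (hopt.integrable _)]
  linarith

lemma ofReal_Qopt_sub_Qπ_le (hR : ∀ x, |M.r x| ≤ Rmax) (hk : 1 ≤ k)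
    (hπstar : πstar.IsGreedy (M.Qopt k)) {f : S × A → ℝ} (hf : BddMeasurable f)
    {π : Policy S A} (hπ : π.IsGreedy f) (x : S × A) :
    ENNReal.ofReal (M.Qopt k x - M.Qπ k π x) ≤
      ENNReal.ofReal M.γ ^ k * ∫⁻ y, ENNReal.ofReal (M.Qopt k y - M.Qπ k π y) ∂(M.Pkπ k π x) +
      ENNReal.ofReal M.γ ^ k * (∫⁻ y, ENNReal.ofReal (M.Qopt k y - f y) ∂(M.Pkπ k πstar x) +
        ∫⁻ y, ENNReal.ofReal (f y - M.Qopt k y) ∂(M.Pkπ k π x)) := by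
  have hopt := bddMeasurable_Qopt hR hk
  refine (ENNReal.ofReal_le_ofReal (Qopt_sub_Qπ_le hR hk hπstar hf hπ x)).trans ?_
  rw [ENNReal.ofReal_mul (pow_nonneg M.γ_nonneg k), ENNReal.ofReal_pow M.γ_nonneg, ← mul_add]
  gcongr
  refine ENNReal.ofReal_add_le.trans (add_le_add
    (ofReal_integral_le_lintegral_ofReal ((hopt.sub (bddMeasurable_Qπ hR k π)).integrable _))
    (ENNReal.ofReal_add_le.trans ?_))
  exact add_le_add (ofReal_integral_le_lintegral_ofReal ((hopt.sub hf).integrable _))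
    (ofReal_integral_le_lintegral_ofReal ((hf.sub hopt).integrable _))

lemma ofReal_Qopt_sub_Qπ_le_tsum (hR : ∀ x, |M.r x| ≤ Rmax) (hk : 1 ≤ k)
    (hπstar : πstar.IsGreedy (M.Qopt k)) {f : S × A → ℝ} (hf : BddMeasurable f)
    {π : Policy S A} (hπ : π.IsGreedy f) (x : S × A) :
    ENNReal.ofReal (M.Qopt k x - M.Qπ k π x) ≤
      ENNReal.ofReal M.γ ^ k * ∑' m : ℕ, ENNReal.ofReal M.γ ^ (k * m) *
        (∫⁻ y, ENNReal.ofReal (M.Qopt k y - f y) ∂((M.Pkπ k πstar ∘ₖ (M.Pkπ k π ^ m)) x) +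
          ∫⁻ y, ENNReal.ofReal (f y - M.Qopt k y) ∂((M.Pkπ k π ^ (m + 1)) x)) := by
  have hopt := bddMeasurable_Qopt (M := M) hR hk
  have hU := (hopt.sub hf).measurable.ennreal_ofReal
  have hV := (hf.sub hopt).measurable.ennreal_ofReal
  have hγk : ENNReal.ofReal M.γ ^ k < 1 := by
    rw [← ENNReal.ofReal_pow M.γ_nonneg, ENNReal.ofReal_lt_one]
    exact γ_pow_lt_one hk
  have hUV : Measurable fun y => ∫⁻ z, ENNReal.ofReal (M.Qopt k z - f z) ∂(M.Pkπ k πstar y) +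
      ∫⁻ z, ENNReal.ofReal (f z - M.Qopt k z) ∂(M.Pkπ k π y) :=
    hU.lintegral_kernel.add hV.lintegral_kernel
  obtain ⟨C, hC⟩ := (hopt.sub (bddMeasurable_Qπ hR k π)).bdd
  have hunroll := le_tsum_lintegral_pow (M.Pkπ k π) hγk (C := ENNReal.ofReal C)
    ENNReal.ofReal_ne_top (hUV.const_mul _)
    (fun y => ENNReal.ofReal_le_ofReal ((le_abs_self _).trans (hC y)))
    (fun y => ofReal_Qopt_sub_Qπ_le hR hk hπstar hf hπ y) x
  refine hunroll.trans_eq ?_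
  rw [← ENNReal.tsum_mul_left]
  congr with m
  rw [lintegral_const_mul _ hUV, lintegral_add_left hU.lintegral_kernel,
    Kernel.lintegral_comp _ _ _ hU, kernel_pow_succ', Kernel.lintegral_comp _ _ _ hV, ← pow_mul,
    mul_left_comm]

end ErrorPropagation

end MDP

section Averaging

variable {X Y ι : Type*} [MeasurableSpace X] [MeasurableSpace Y]

/-- The countable mixture `∑ i, w i κ i` of the kernels `κ i` with weights `w i`. -/
def mixtureKernel [Countable ι] (w : ι → ℝ≥0∞) (κ : ι → Kernel X Y) [∀ i, IsSFiniteKernel (κ i)] :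
    Kernel X Y :=
  Kernel.sum fun i => (κ i).withDensity fun _ _ => w i

lemma lintegral_mixtureKernel [Countable ι] (w : ι → ℝ≥0∞) (κ : ι → Kernel X Y)
    [∀ i, IsSFiniteKernel (κ i)] {f : Y → ℝ≥0∞} (hf : Measurable f) (x : X) :
    ∫⁻ y, f y ∂(mixtureKernel w κ x) = ∑' i, w i * ∫⁻ y, f y ∂(κ i x) := by
  rw [mixtureKernel, Kernel.sum_apply, lintegral_sum_measure]
  congr with i
  rw [Kernel.lintegral_withDensity _ measurable_const _ hf, lintegral_const_mul _ hf]

lemma isMarkovKernel_mixtureKernel [Countable ι] {w : ι → ℝ≥0∞} {κ : ι → Kernel X Y}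
    [∀ i, IsSFiniteKernel (κ i)] (h : ∀ x, ∑' i, w i * κ i x Set.univ = 1) :
    IsMarkovKernel (mixtureKernel w κ) := by
  refine ⟨fun x => ⟨?_⟩⟩
  rw [← lintegral_one, lintegral_mixtureKernel w κ measurable_const]
  simpa only [lintegral_one] using h x

lemma lintegral_bind_mixtureKernel [Countable ι] (w : ι → ℝ≥0∞) (κ : ι → Kernel X Y)
    [∀ i, IsSFiniteKernel (κ i)] (μ : Measure X) {f : Y → ℝ≥0∞} (hf : Measurable f) :
    ∫⁻ y, f y ∂(μ.bind (mixtureKernel w κ)) = ∑' i, w i * ∫⁻ y, f y ∂(μ.bind (κ i)) := by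
  rw [Measure.lintegral_bind (Kernel.aemeasurable _) hf.aemeasurable]
  simp_rw [lintegral_mixtureKernel w κ hf]
  rw [lintegral_tsum fun i => (hf.lintegral_kernel.const_mul _).aemeasurable]
  congr with i
  rw [lintegral_const_mul _ hf.lintegral_kernel,
    Measure.lintegral_bind (Kernel.aemeasurable _) hf.aemeasurable]

lemma rpow_lintegral_le_lintegral_rpow (μ : Measure X) [IsProbabilityMeasure μ] {p : ℝ}
    (hp : 1 ≤ p) {f : X → ℝ≥0∞} (hf : Measurable f) :
    (∫⁻ x, f x ∂μ) ^ p ≤ ∫⁻ x, f x ^ p ∂μ := by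
  have hnorm := eLpNorm'_le_eLpNorm'_of_exponent_le zero_lt_one hp μ hf.aestronglyMeasurable
  rw [eLpNorm', eLpNorm', one_div_one, ENNReal.rpow_one, one_div,
    ENNReal.le_rpow_inv_iff (by positivity)] at hnorm
  simpa only [enorm_eq_self, ENNReal.rpow_one] using hnorm

lemma rpow_sum_mul_add_le (s : Finset ι) (w z : ι → ℝ≥0∞) {a c : ℝ≥0∞}
    (hw : ∑ i ∈ s, w i + a = 1) {p : ℝ} (hp : 1 ≤ p) :
    (∑ i ∈ s, w i * z i + a * c) ^ p ≤ ∑ i ∈ s, w i * z i ^ p + a * c ^ p := by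
  have hmean := ENNReal.rpow_arith_mean_le_arith_mean_rpow s.insertNone
    (fun o => o.elim a w) (fun o => o.elim c z) (by rw [Finset.sum_insertNone, add_comm]; exact hw)
    hp
  simpa only [Finset.sum_insertNone, Option.elim, add_comm] using hmean

lemma lintegral_rpow_sum_lintegral_add_le (μ : Measure X) [IsProbabilityMeasure μ] (s : Finset ι)
    {w : ι → ℝ≥0∞} {a c : ℝ≥0∞} (hw : ∑ i ∈ s, w i + a = 1) {p : ℝ} (hp : 1 ≤ p)
    (κ : ι → Kernel X Y) [∀ i, IsMarkovKernel (κ i)] {f : ι → Y → ℝ≥0∞}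
    (hf : ∀ i ∈ s, Measurable (f i)) :
    ∫⁻ x, (∑ i ∈ s, w i * ∫⁻ y, f i y ∂(κ i x) + a * c) ^ p ∂μ ≤
      ∑ i ∈ s, w i * ∫⁻ y, f i y ^ p ∂(μ.bind (κ i)) + a * c ^ p := by
  have hmoment {i : ι} (hi : i ∈ s) : Measurable fun x => ∫⁻ y, f i y ^ p ∂(κ i x) :=
    ((hf i hi).pow_const p).lintegral_kernel
  calc ∫⁻ x, (∑ i ∈ s, w i * ∫⁻ y, f i y ∂(κ i x) + a * c) ^ p ∂μ
      ≤ ∫⁻ x, (∑ i ∈ s, w i * ∫⁻ y, f i y ^ p ∂(κ i x) + a * c ^ p) ∂μ := by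
        refine lintegral_mono fun x => (rpow_sum_mul_add_le s w _ hw hp).trans ?_
        gcongr with i hi
        exact rpow_lintegral_le_lintegral_rpow _ hp (hf i hi)
    _ = ∑ i ∈ s, w i * ∫⁻ y, f i y ^ p ∂(μ.bind (κ i)) + a * c ^ p := by
        rw [lintegral_add_right _ measurable_const, lintegral_const, measure_univ, mul_one,
          lintegral_finsetSum _ fun i hi => (hmoment hi).const_mul _]
        congr 1
        refine Finset.sum_congr rfl fun i hi => ?_
        rw [lintegral_const_mul _ (hmoment hi), Measure.lintegral_bind (Kernel.aemeasurable _)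
          ((hf i hi).pow_const p).aemeasurable]

lemma ennreal_tsum_mul_sum_add {κ : Type*} (s : Finset κ) (w : ι → ℝ≥0∞) (a : κ → ℝ≥0∞)
    (e : ι → κ → ℝ≥0∞) (b : ℝ≥0∞) :
    ∑' i, w i * (∑ j ∈ s, a j * e i j + b) =
      ∑ j ∈ s, a j * ∑' i, w i * e i j + (∑' i, w i) * b := by
  simp only [mul_add, Finset.mul_sum, mul_left_comm (w _) (a _)]
  rw [ENNReal.tsum_add, Summable.tsum_finsetSum fun _ _ => ENNReal.summable,
    ENNReal.tsum_mul_right]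
  simp only [ENNReal.tsum_mul_left]

end Averaging

section ChangeOfMeasure

variable {X ι : Type*} [MeasurableSpace X]

lemma eLpNorm_toReal_rnDeriv {μ ν : Measure X} [SigmaFinite μ] (q : ℝ≥0∞) :
    eLpNorm (fun x => (μ.rnDeriv ν x).toReal) q ν = eLpNorm (μ.rnDeriv ν) q ν := by
  refine eLpNorm_congr_enorm_ae ?_
  filter_upwards [μ.rnDeriv_lt_top ν] with x hx
  rw [Real.enorm_of_nonneg ENNReal.toReal_nonneg, ENNReal.ofReal_toReal hx.ne, enorm_eq_self]

lemma lintegral_enorm_rpow_le_densityNorm_mul {μ ν : Measure X} [SigmaFinite μ] [SigmaFinite ν]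
    {p : ℝ} (hp : 0 < p) {q : ℝ≥0∞} (hq : 1 ≤ q) (hμν : densityNorm q μ ν ≠ ⊤) {f : X → ℝ}
    (hf : Measurable f) :
    ∫⁻ x, ‖f x‖ₑ ^ p ∂μ ≤ densityNorm q μ ν * eLpNorm f (ENNReal.ofReal p * q) ν ^ p := by
  have hac : μ ≪ ν := by
    by_contra h
    exact hμν (if_neg h)
  have hconj : ENNReal.HolderConjugate q.conjExponent q :=
    (ENNReal.HolderConjugate.conjExponent hq).symm
  have hdensity : ∫⁻ x, ‖f x‖ₑ ^ p ∂μ =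
      eLpNorm ((fun x => (μ.rnDeriv ν x).toReal) • fun x => ‖f x‖ ^ p) 1 ν := by
    rw [← lintegral_rnDeriv_mul hac (hf.enorm.pow_const p).aemeasurable,
      eLpNorm_one_eq_lintegral_enorm]
    refine lintegral_congr_ae ?_
    filter_upwards [μ.rnDeriv_lt_top ν] with x hx
    rw [Pi.smul_apply', smul_eq_mul, enorm_mul, Real.enorm_of_nonneg ENNReal.toReal_nonneg,
      ENNReal.ofReal_toReal hx.ne, Real.enorm_rpow_of_nonneg (norm_nonneg _) hp.le, enorm_norm]
  rw [hdensity, densityNorm, if_pos hac, ← eLpNorm_toReal_rnDeriv, mul_comm (ENNReal.ofReal p) q,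
    ← eLpNorm_norm_rpow f hp]
  exact eLpNorm_smul_le_mul_eLpNorm (hf.norm.pow_const p).aestronglyMeasurable
    (Measure.measurable_rnDeriv μ ν).ennreal_toReal.aestronglyMeasurable

lemma sum_mul_mul_le_rpow_mul_rpow (s : Finset ι) {w : ι → ℝ≥0∞} (hw₀ : ∀ i ∈ s, w i ≠ 0)
    (hw : ∀ i ∈ s, w i ≠ ⊤) (b e : ι → ℝ≥0∞) (r : ℝ) :
    ∑ i ∈ s, w i * b i * e i ≤
      (∑ i ∈ s, w i ^ (2 * (1 - r)) * b i ^ 2) ^ (1 / 2 : ℝ) *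
        (∑ i ∈ s, w i ^ (2 * r) * e i ^ 2) ^ (1 / 2 : ℝ) := by
  have hsq (u v : ℝ≥0∞) (t : ℝ) : (u ^ t * v) ^ (2 : ℝ) = u ^ (2 * t) * v ^ 2 := by
    rw [ENNReal.mul_rpow_of_nonneg _ _ zero_le_two, ← ENNReal.rpow_mul, mul_comm t,
      ENNReal.rpow_two]
  have hcs := ENNReal.inner_le_Lp_mul_Lq s (fun i => w i ^ (1 - r) * b i) (fun i => w i ^ r * e i)
    Real.HolderConjugate.two_two
  simp only [hsq] at hcs
  refine le_trans (Finset.sum_congr rfl fun i hi => ?_).le hcs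
  have hsplit : w i = w i ^ (1 - r) * w i ^ r := by
    rw [← ENNReal.rpow_add _ _ (hw₀ i hi) (hw i hi), sub_add_cancel, ENNReal.rpow_one]
  rw [mul_mul_mul_comm, ← hsplit, mul_assoc]

end ChangeOfMeasure

namespace MDP

variable {S A : Type*} [MeasurableSpace S] [MeasurableSpace A]

section Weights

variable (M : MDP S A)

/-- The weight of the initial error `Q_k^* - Q^(0)`, which completes the weights `α_j` of the
errors `ε^(j)` to a probability vector. -/
def initialWeight (J : ℕ) : ℝ := (1 - M.γ) * M.γ ^ J / (1 - M.γ ^ (J + 1))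

lemma initialWeight_le (J : ℕ) : M.initialWeight J ≤ M.γ ^ J := by
  have hJ : 0 < 1 - M.γ ^ (J + 1) := sub_pos.2 (γ_pow_lt_one J.succ_pos)
  rw [initialWeight, div_le_iff₀ hJ, mul_comm]
  gcongr
  · exact pow_nonneg M.γ_nonneg J
  · exact pow_le_of_le_one M.γ_nonneg M.γ_lt_one.le J.succ_ne_zero

lemma sum_α_add_initialWeight (J : ℕ) :
    ∑ j ∈ Finset.range J, ENNReal.ofReal (M.α J j) + ENNReal.ofReal (M.initialWeight J) = 1 := by
  have hγ : 0 < 1 - M.γ := sub_pos.2 M.γ_lt_one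
  have hJ : 0 < 1 - M.γ ^ (J + 1) := sub_pos.2 (γ_pow_lt_one J.succ_pos)
  have hweight (n : ℕ) : 0 ≤ (1 - M.γ) * M.γ ^ n / (1 - M.γ ^ (J + 1)) :=
    div_nonneg (mul_nonneg hγ.le (pow_nonneg M.γ_nonneg n)) hJ.le
  have hreflect : ∑ j ∈ Finset.range J, M.γ ^ (J - j - 1) = ∑ j ∈ Finset.range J, M.γ ^ j := by
    rw [← Finset.sum_range_reflect (fun j => M.γ ^ j) J]
    exact Finset.sum_congr rfl fun j _ => by rw [Nat.sub_right_comm]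
  simp only [α, initialWeight]
  rw [← ENNReal.ofReal_sum_of_nonneg fun j _ => hweight _,
    ← ENNReal.ofReal_add (Finset.sum_nonneg fun j _ => hweight _) (hweight J), ← Finset.sum_div,
    ← Finset.mul_sum, hreflect, ← add_div, ← mul_add, ← Finset.sum_range_succ, mul_neg_geom_sum,
    div_self hJ.ne', ENNReal.ofReal_one]

variable {M}

lemma α_pos (hγ : 0 < M.γ) (J j : ℕ) : 0 < M.α J j := by
  have hγ1 : 0 < 1 - M.γ := sub_pos.2 M.γ_lt_one
  have hJ : 0 < 1 - M.γ ^ (J + 1) := sub_pos.2 (γ_pow_lt_one J.succ_pos)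
  unfold α
  positivity

lemma ofReal_le_mul_ofReal_normalized {c : ℝ} (hc : 0 ≤ c) (J : ℕ) :
    ENNReal.ofReal c ≤ ENNReal.ofReal (1 / (1 - M.γ)) *
      ENNReal.ofReal ((1 - M.γ) * c / (1 - M.γ ^ (J + 1))) := by
  have hγ : 0 < 1 - M.γ := sub_pos.2 M.γ_lt_one
  have hJ : 0 < 1 - M.γ ^ (J + 1) := sub_pos.2 (γ_pow_lt_one J.succ_pos)
  rw [← ENNReal.ofReal_mul (by positivity), mul_div_assoc, ← mul_assoc,
    one_div_mul_cancel hγ.ne', one_mul]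
  exact ENNReal.ofReal_le_ofReal (le_div_self hc hJ (sub_le_self _ (pow_nonneg M.γ_nonneg _)))

lemma tsum_ofReal_γ_pow_mul_two {k : ℕ} (hk : 1 ≤ k) :
    (∑' m : ℕ, ENNReal.ofReal (M.γ ^ (k * m))) * 2 = ENNReal.ofReal (2 / (1 - M.γ ^ k)) := by
  have hsum := hasSum_geometric_of_lt_one (pow_nonneg M.γ_nonneg k) (γ_pow_lt_one hk)
  simp only [← pow_mul] at hsum
  rw [← ENNReal.ofReal_tsum_of_nonneg (fun m => pow_nonneg M.γ_nonneg _) hsum.summable,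
    hsum.tsum_eq, ← ENNReal.ofReal_ofNat 2, ← ENNReal.ofReal_mul' zero_le_two, div_eq_inv_mul]

lemma ofReal_half_mul_ofReal_two_div {k : ℕ} (hk : 1 ≤ k) :
    ENNReal.ofReal ((1 - M.γ ^ k) / 2) * ENNReal.ofReal (2 / (1 - M.γ ^ k)) = 1 := by
  have hγk : 0 < 1 - M.γ ^ k := sub_pos.2 (γ_pow_lt_one hk)
  rw [← ENNReal.ofReal_mul (by positivity), div_mul_div_cancel₀ two_ne_zero, div_self hγk.ne',
    ENNReal.ofReal_one]

end Weights

section AveragedKernel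

variable (M : MDP S A)

/-- The average over the unrolling depth `m` of the kernels that transport the error `ε^(j)`; the
normalization of the discounted weights is what produces the factor `(1 - γ^k) / 2` in `CVI`. -/
def avgErrKernel (k : ℕ) (πstar : Policy S A) (J j : ℕ) (π : ℕ → Policy S A) :
    Kernel (S × A) (S × A) :=
  mixtureKernel (fun m => ENNReal.ofReal ((1 - M.γ ^ k) / 2) * ENNReal.ofReal (M.γ ^ (k * m)))
    fun m => M.errKernel₁ k πstar m (J / k - j / k) (k - j % k - 1) (π J) +
      M.errKernel₂ k (m + 1) (k - j % k - 1) (j / k) (J / k - j / k) π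

lemma isMarkovKernel_avgErrKernel {k : ℕ} (hk : 1 ≤ k) (πstar : Policy S A) (J j : ℕ)
    (π : ℕ → Policy S A) : IsMarkovKernel (M.avgErrKernel k πstar J j π) := by
  refine isMarkovKernel_mixtureKernel fun x => ?_
  simp only [add_apply, Measure.add_apply, measure_univ, one_add_one_eq_two]
  rw [ENNReal.tsum_mul_right, ENNReal.tsum_mul_left, mul_assoc, tsum_ofReal_γ_pow_mul_two hk,
    ofReal_half_mul_ofReal_two_div hk]

lemma lintegral_avgErrKernel (k : ℕ) (πstar : Policy S A) (J j : ℕ) (π : ℕ → Policy S A)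
    {f : S × A → ℝ≥0∞} (hf : Measurable f) (x : S × A) :
    ∫⁻ y, f y ∂(M.avgErrKernel k πstar J j π x) =
      ENNReal.ofReal ((1 - M.γ ^ k) / 2) * ∑' m : ℕ, ENNReal.ofReal (M.γ ^ (k * m)) *
        (∫⁻ y, f y ∂(M.errKernel₁ k πstar m (J / k - j / k) (k - j % k - 1) (π J) x) +
          ∫⁻ y, f y ∂(M.errKernel₂ k (m + 1) (k - j % k - 1) (j / k) (J / k - j / k) π x)) := by
  rw [avgErrKernel, lintegral_mixtureKernel _ _ hf, ← ENNReal.tsum_mul_left]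
  simp only [add_apply, lintegral_add_measure, mul_assoc]

lemma lintegral_bind_avgErrKernel (k : ℕ) (πstar : Policy S A) (J j : ℕ) (π : ℕ → Policy S A)
    (ρ : Measure (S × A)) {f : S × A → ℝ≥0∞} (hf : Measurable f) :
    ∫⁻ y, f y ∂(ρ.bind (M.avgErrKernel k πstar J j π)) =
      ENNReal.ofReal ((1 - M.γ ^ k) / 2) * ∑' m : ℕ, ENNReal.ofReal (M.γ ^ (k * m)) *
        (∫⁻ y, f y ∂(ρ.bind (M.errKernel₁ k πstar m (J / k - j / k) (k - j % k - 1) (π J))) +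
          ∫⁻ y, f y
            ∂(ρ.bind (M.errKernel₂ k (m + 1) (k - j % k - 1) (j / k) (J / k - j / k) π))) := by
  rw [avgErrKernel, lintegral_bind_mixtureKernel _ _ _ hf, ← ENNReal.tsum_mul_left]
  simp only [Measure.add_comp, lintegral_add_measure, mul_assoc]

end AveragedKernel

section PerformanceLoss

variable [Finite A] [Nonempty A] {M : MDP S A} {Rmax : ℝ} {k J : ℕ} {Q : ℕ → S × A → ℝ}
  {πstar : Policy S A} {π : ℕ → Policy S A} {c₀ : ℝ}

lemma ofReal_Qopt_sub_Qπ_le_tsum_sum (hR : ∀ x, |M.r x| ≤ Rmax) (hk : 1 ≤ k) (hkJ : k ∣ J)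
    (hπstar : πstar.IsGreedy (M.Qopt k)) (hQ : ∀ j ≤ J, BddMeasurable (Q j))
    (h0 : ∀ x, |M.Qopt k x - Q 0 x| ≤ c₀) (hπ : ∀ j ≤ J, (π j).IsGreedy (Q j)) (x : S × A) :
    ENNReal.ofReal (M.Qopt k x - M.Qπ k (π J) x) ≤
      ENNReal.ofReal (M.γ ^ k) * ∑' m : ℕ, ENNReal.ofReal (M.γ ^ (k * m)) *
        (∑ j ∈ Finset.range J, ENNReal.ofReal (M.γ ^ (J - j - 1)) *
          (∫⁻ y, ‖M.err k Q j y‖ₑ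
            ∂(M.errKernel₁ k πstar m (J / k - j / k) (k - j % k - 1) (π J) x) +
          ∫⁻ y, ‖M.err k Q j y‖ₑ
            ∂(M.errKernel₂ k (m + 1) (k - j % k - 1) (j / k) (J / k - j / k) π x)) +
          2 * (ENNReal.ofReal (M.γ ^ J) * ENNReal.ofReal c₀)) := by
  refine (ofReal_Qopt_sub_Qπ_le_tsum hR hk hπstar (hQ J le_rfl) (hπ J le_rfl) x).trans ?_
  simp only [ENNReal.ofReal_pow M.γ_nonneg]
  refine mul_le_mul_right (ENNReal.tsum_le_tsum fun m => mul_le_mul_right ?_ _) _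
  refine (add_le_add (lintegral_ofReal_Qopt_sub_le hR hk hkJ hπstar hQ h0 (π J) m x)
    (lintegral_ofReal_sub_Qopt_le hR hk hkJ hQ h0 (fun j hj _ => hπ j hj.le) (m + 1) x)).trans_eq ?_
  simp only [mul_add, Finset.sum_add_distrib]
  ring

lemma ofReal_Qopt_sub_Qπ_le_sum_avg (hR : ∀ x, |M.r x| ≤ Rmax) (hk : 1 ≤ k) (hkJ : k ∣ J)
    (hπstar : πstar.IsGreedy (M.Qopt k)) (hQ : ∀ j ≤ J, BddMeasurable (Q j))
    (h0 : ∀ x, |M.Qopt k x - Q 0 x| ≤ c₀) (hπ : ∀ j ≤ J, (π j).IsGreedy (Q j)) (x : S × A) :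
    ENNReal.ofReal (M.Qopt k x - M.Qπ k (π J) x) ≤
      ENNReal.ofReal (2 * M.γ ^ k / (1 - M.γ ^ k)) *
        (∑ j ∈ Finset.range J, ENNReal.ofReal (M.γ ^ (J - j - 1)) *
            ∫⁻ y, ‖M.err k Q j y‖ₑ ∂(M.avgErrKernel k πstar J j π x) +
          ENNReal.ofReal (M.γ ^ J) * ENNReal.ofReal c₀) := by
  refine (ofReal_Qopt_sub_Qπ_le_tsum_sum hR hk hkJ hπstar hQ h0 hπ x).trans_eq ?_
  rw [ennreal_tsum_mul_sum_add, ← mul_assoc (∑' m : ℕ, _), tsum_ofReal_γ_pow_mul_two hk,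
    mul_comm 2, mul_div_assoc, ENNReal.ofReal_mul (pow_nonneg M.γ_nonneg k),
    mul_assoc _ _ (_ + _), mul_add (ENNReal.ofReal (2 / _)), Finset.mul_sum]
  congr 2
  refine Finset.sum_congr rfl fun j hj => ?_
  rw [lintegral_avgErrKernel _ _ _ _ _ _
      (bddMeasurable_err hR hQ (Finset.mem_range.1 hj)).measurable.enorm, mul_left_comm,
    ← mul_assoc (ENNReal.ofReal (2 / _)), mul_comm (ENNReal.ofReal (2 / _)),
    ofReal_half_mul_ofReal_two_div hk, one_mul]

lemma ofReal_Qopt_sub_Qπ_le_weighted_sum (hR : ∀ x, |M.r x| ≤ Rmax) (hk : 1 ≤ k) (hkJ : k ∣ J)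
    (hπstar : πstar.IsGreedy (M.Qopt k)) (hQ : ∀ j ≤ J, BddMeasurable (Q j))
    (h0 : ∀ x, |M.Qopt k x - Q 0 x| ≤ c₀) (hπ : ∀ j ≤ J, (π j).IsGreedy (Q j)) (x : S × A) :
    ENNReal.ofReal (M.Qopt k x - M.Qπ k (π J) x) ≤
      ENNReal.ofReal (2 * M.γ ^ k / ((1 - M.γ) * (1 - M.γ ^ k))) *
        (∑ j ∈ Finset.range J, ENNReal.ofReal (M.α J j) *
            ∫⁻ y, ‖M.err k Q j y‖ₑ ∂(M.avgErrKernel k πstar J j π x) +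
          ENNReal.ofReal (M.initialWeight J) * ENNReal.ofReal c₀) := by
  have hprefactor : ENNReal.ofReal (2 * M.γ ^ k / ((1 - M.γ) * (1 - M.γ ^ k))) =
      ENNReal.ofReal (2 * M.γ ^ k / (1 - M.γ ^ k)) * ENNReal.ofReal (1 / (1 - M.γ)) := by
    rw [← ENNReal.ofReal_mul' (one_div_nonneg.2 (sub_nonneg.2 M.γ_lt_one.le)), mul_one_div,
      div_div, mul_comm (1 - M.γ)]
  have hweight {c : ℝ} (hc : 0 ≤ c) (z : ℝ≥0∞) : ENNReal.ofReal c * z ≤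
      ENNReal.ofReal (1 / (1 - M.γ)) *
        (ENNReal.ofReal ((1 - M.γ) * c / (1 - M.γ ^ (J + 1))) * z) := by
    rw [← mul_assoc]
    gcongr
    exact ofReal_le_mul_ofReal_normalized hc J
  refine (ofReal_Qopt_sub_Qπ_le_sum_avg hR hk hkJ hπstar hQ h0 hπ x).trans ?_
  rw [hprefactor, mul_assoc, mul_add (ENNReal.ofReal (1 / _)), Finset.mul_sum]
  refine mul_le_mul_right (add_le_add (Finset.sum_le_sum fun j _ => ?_) ?_) _
  · exact hweight (pow_nonneg M.γ_nonneg _) _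
  · exact hweight (pow_nonneg M.γ_nonneg _) _

lemma lintegral_rpow_Qopt_sub_Qπ_le (hR : ∀ x, |M.r x| ≤ Rmax) (hk : 1 ≤ k) (hkJ : k ∣ J)
    (hπstar : πstar.IsGreedy (M.Qopt k)) (hQ : ∀ j ≤ J, BddMeasurable (Q j))
    (h0 : ∀ x, |M.Qopt k x - Q 0 x| ≤ c₀) (hπ : ∀ j ≤ J, (π j).IsGreedy (Q j))
    (ρ : Measure (S × A)) [IsProbabilityMeasure ρ] {p : ℝ} (hp : 1 ≤ p) :
    ∫⁻ x, ENNReal.ofReal (M.Qopt k x - M.Qπ k (π J) x) ^ p ∂ρ ≤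
      ENNReal.ofReal (2 * M.γ ^ k / ((1 - M.γ) * (1 - M.γ ^ k))) ^ p *
        (∑ j ∈ Finset.range J, ENNReal.ofReal (M.α J j) *
            ∫⁻ y, ‖M.err k Q j y‖ₑ ^ p ∂(ρ.bind (M.avgErrKernel k πstar J j π)) +
          ENNReal.ofReal (M.γ ^ J) * ENNReal.ofReal c₀ ^ p) := by
  have hp0 : 0 ≤ p := zero_le_one.trans hp
  have hmarkov (j : ℕ) : IsMarkovKernel (M.avgErrKernel k πstar J j π) :=
    M.isMarkovKernel_avgErrKernel hk πstar J j π
  refine (lintegral_mono fun x => ENNReal.rpow_le_rpow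
    (ofReal_Qopt_sub_Qπ_le_weighted_sum hR hk hkJ hπstar hQ h0 hπ x) hp0).trans ?_
  simp only [ENNReal.mul_rpow_of_nonneg _ _ hp0]
  rw [lintegral_const_mul' _ _ (ENNReal.rpow_ne_top_of_nonneg hp0 ENNReal.ofReal_ne_top)]
  gcongr
  refine (lintegral_rpow_sum_lintegral_add_le ρ _ (M.sum_α_add_initialWeight J) hp _ fun j hj =>
    (bddMeasurable_err hR hQ (Finset.mem_range.1 hj)).measurable.enorm).trans ?_
  gcongr
  exact M.initialWeight_le J

end PerformanceLoss

section DiscountedConcentrability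

/-- The discounted sum of persistent concentrability coefficients attached to the error made at
step `j`, which is squared and summed over `j` in `CVI`. -/
def discountedCoeff (M : MDP S A) (k : ℕ) (q : ℝ≥0∞) (ρ ν : Measure (S × A)) (πstar : Policy S A)
    (J j : ℕ) (π : ℕ → Policy S A) : ℝ≥0∞ :=
  ∑' m : ℕ, ENNReal.ofReal (M.γ ^ (k * m)) *
    (M.cVI₁ k q ρ ν πstar m (J / k - j / k) (k - j % k - 1) (π J) +
      M.cVI₂ k q ρ ν (m + 1) (k - j % k - 1) (J / k - j / k) (fun l => π (k * (j / k + l))))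

variable {M : MDP S A} {k J : ℕ} {q : ℝ≥0∞} {ρ ν : Measure (S × A)} {πstar : Policy S A} {p : ℝ}

lemma sum_discountedCoeff_le_CVI (π : ℕ → Policy S A) (r : ℝ) :
    ENNReal.ofReal ((1 - M.γ ^ k) / 2) ^ 2 * ∑ j ∈ Finset.range J,
      ENNReal.ofReal (M.α J j) ^ (2 * (1 - r)) * M.discountedCoeff k q ρ ν πstar J j π ^ 2 ≤
      M.CVI k πstar ρ ν J r q := by
  unfold CVI
  gcongr
  exact le_iSup_of_le π le_rfl

lemma discountedCoeff_ne_top (hγ : 0 < M.γ) (hk : 1 ≤ k) {r : ℝ}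
    (hC : M.CVI k πstar ρ ν J r q ≠ ⊤) (π : ℕ → Policy S A) {j : ℕ} (hj : j < J) :
    M.discountedCoeff k q ρ ν πstar J j π ≠ ⊤ := by
  intro htop
  have hγk : 0 < (1 - M.γ ^ k) / 2 := half_pos (sub_pos.2 (γ_pow_lt_one hk))
  have hα : ENNReal.ofReal (M.α J j) ^ (2 * (1 - r)) ≠ 0 :=
    (ENNReal.rpow_pos (ENNReal.ofReal_pos.2 (α_pos hγ J j)) ENNReal.ofReal_ne_top).ne'
  have hterm : ENNReal.ofReal (M.α J j) ^ (2 * (1 - r)) *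
      M.discountedCoeff k q ρ ν πstar J j π ^ 2 = ⊤ := by
    rw [htop, ENNReal.top_pow two_ne_zero, ENNReal.mul_top hα]
  refine hC (top_unique ((Eq.ge ?_).trans (sum_discountedCoeff_le_CVI π r)))
  rw [ENNReal.sum_eq_top.2 ⟨j, Finset.mem_range.2 hj, hterm⟩,
    ENNReal.mul_top (pow_ne_zero _ (ENNReal.ofReal_pos.2 hγk).ne')]

lemma lintegral_enorm_rpow_bind_avgErrKernel_le [IsProbabilityMeasure ρ] [SigmaFinite ν]
    (hγ : 0 < M.γ) (hp : 0 < p) (hq : 1 ≤ q) {f : S × A → ℝ} (hf : Measurable f) {j : ℕ}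
    {π : ℕ → Policy S A} (hfin : M.discountedCoeff k q ρ ν πstar J j π ≠ ⊤) :
    ∫⁻ y, ‖f y‖ₑ ^ p ∂(ρ.bind (M.avgErrKernel k πstar J j π)) ≤
      ENNReal.ofReal ((1 - M.γ ^ k) / 2) * M.discountedCoeff k q ρ ν πstar J j π *
        eLpNorm f (ENNReal.ofReal p * q) ν ^ p := by
  rw [lintegral_bind_avgErrKernel M k πstar J j π ρ (hf.enorm.pow_const p), mul_assoc,
    discountedCoeff, ← ENNReal.tsum_mul_right]
  refine mul_le_mul_right (ENNReal.tsum_le_tsum fun m => ?_) _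
  have hcoeff := fun h => ENNReal.ne_top_of_tsum_ne_top hfin m
    ((congrArg _ h).trans (ENNReal.mul_top (ENNReal.ofReal_pos.2 (pow_pos hγ (k * m))).ne'))
  rw [cVI₁_eq_densityNorm, cVI₂_eq_densityNorm] at hcoeff ⊢
  obtain ⟨h₁, h₂⟩ := ENNReal.add_ne_top.1 hcoeff
  rw [mul_assoc, add_mul]
  exact mul_le_mul_right (add_le_add (lintegral_enorm_rpow_le_densityNorm_mul hp hq h₁ hf)
    (lintegral_enorm_rpow_le_densityNorm_mul hp hq h₂ hf)) _

lemma sum_α_mul_lintegral_le_CVI_mul_errAgg [IsProbabilityMeasure ρ] [SigmaFinite ν]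
    (hγ : 0 < M.γ) (hk : 1 ≤ k) (hp : 0 < p) (hq : 1 ≤ q) {r : ℝ}
    (hC : M.CVI k πstar ρ ν J r q ≠ ⊤) {ε : ℕ → S × A → ℝ} (hε : ∀ j < J, Measurable (ε j))
    (π : ℕ → Policy S A) :
    ∑ j ∈ Finset.range J, ENNReal.ofReal (M.α J j) *
        ∫⁻ y, ‖ε j y‖ₑ ^ p ∂(ρ.bind (M.avgErrKernel k πstar J j π)) ≤
      M.CVI k πstar ρ ν J r q ^ (1 / 2 : ℝ) * M.errAgg p ν J ε r q ^ (1 / 2 : ℝ) := by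
  set c := ENNReal.ofReal ((1 - M.γ ^ k) / 2)
  have hsq (z : ℝ≥0∞) : (z ^ p) ^ 2 = z ^ (2 * p) := by
    rw [← ENNReal.rpow_mul_natCast, mul_comm, Nat.cast_ofNat]
  calc _ ≤ ∑ j ∈ Finset.range J, ENNReal.ofReal (M.α J j) *
          (c * M.discountedCoeff k q ρ ν πstar J j π) *
            eLpNorm (ε j) (ENNReal.ofReal p * q) ν ^ p :=
        Finset.sum_le_sum fun j hj => by
          rw [mul_assoc (ENNReal.ofReal _)]
          exact mul_le_mul_right (lintegral_enorm_rpow_bind_avgErrKernel_le hγ hp hq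
            (hε j (Finset.mem_range.1 hj))
            (discountedCoeff_ne_top hγ hk hC π (Finset.mem_range.1 hj))) _
    _ ≤ (∑ j ∈ Finset.range J, ENNReal.ofReal (M.α J j) ^ (2 * (1 - r)) *
            (c * M.discountedCoeff k q ρ ν πstar J j π) ^ 2) ^ (1 / 2 : ℝ) *
          (∑ j ∈ Finset.range J, ENNReal.ofReal (M.α J j) ^ (2 * r) *
            (eLpNorm (ε j) (ENNReal.ofReal p * q) ν ^ p) ^ 2) ^ (1 / 2 : ℝ) :=
        sum_mul_mul_le_rpow_mul_rpow _
          (fun j _ => (ENNReal.ofReal_pos.2 (α_pos hγ J j)).ne')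
          (fun _ _ => ENNReal.ofReal_ne_top) _ _ r
    _ = (c ^ 2 * ∑ j ∈ Finset.range J, ENNReal.ofReal (M.α J j) ^ (2 * (1 - r)) *
            M.discountedCoeff k q ρ ν πstar J j π ^ 2) ^ (1 / 2 : ℝ) *
          M.errAgg p ν J ε r q ^ (1 / 2 : ℝ) := by
        simp only [mul_pow, mul_left_comm _ (c ^ 2), ← Finset.mul_sum, hsq, errAgg]
    _ ≤ _ := mul_le_mul_left
        (ENNReal.rpow_le_rpow (sum_discountedCoeff_le_CVI π r) one_half_pos.le) _

end DiscountedConcentrability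

section NormBound

variable [Finite A] [Nonempty A] {M : MDP S A} {Rmax : ℝ} {k J : ℕ} {Q : ℕ → S × A → ℝ}
  {πstar : Policy S A} {π : ℕ → Policy S A} {c₀ : ℝ}

lemma eLpNorm_Qopt_sub_Qπ_le (hR : ∀ x, |M.r x| ≤ Rmax) (hk : 1 ≤ k) (hkJ : k ∣ J)
    (hπstar : πstar.IsGreedy (M.Qopt k)) (hQ : ∀ j ≤ J, BddMeasurable (Q j))
    (h0 : ∀ x, |M.Qopt k x - Q 0 x| ≤ c₀) (hπ : ∀ j ≤ J, (π j).IsGreedy (Q j))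
    (ρ : Measure (S × A)) [IsProbabilityMeasure ρ] {p : ℝ} (hp : 1 ≤ p) :
    eLpNorm (fun x => M.Qopt k x - M.Qπ k (π J) x) (ENNReal.ofReal p) ρ ≤
      ENNReal.ofReal (2 * M.γ ^ k / ((1 - M.γ) * (1 - M.γ ^ k))) *
        (ENNReal.ofReal (M.γ ^ ((J : ℝ) / p)) * ENNReal.ofReal c₀ +
          (∑ j ∈ Finset.range J, ENNReal.ofReal (M.α J j) *
            ∫⁻ y, ‖M.err k Q j y‖ₑ ^ p ∂(ρ.bind (M.avgErrKernel k πstar J j π))) ^ p⁻¹) := by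
  have hp0 : 0 < p := zero_lt_one.trans_le hp
  have hΔ (x : S × A) : ‖M.Qopt k x - M.Qπ k (π J) x‖ₑ =
      ENNReal.ofReal (M.Qopt k x - M.Qπ k (π J) x) :=
    Real.enorm_of_nonneg (sub_nonneg.2 (Qπ_le_Qopt hR hk (π J) x))
  have hγJ : ENNReal.ofReal (M.γ ^ J) ^ p⁻¹ = ENNReal.ofReal (M.γ ^ ((J : ℝ) / p)) := by
    rw [ENNReal.ofReal_rpow_of_nonneg (pow_nonneg M.γ_nonneg J) (inv_nonneg.2 hp0.le),
      ← Real.rpow_natCast_mul M.γ_nonneg, div_eq_mul_inv]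
  rw [eLpNorm_eq_lintegral_rpow_enorm_toReal (ENNReal.ofReal_pos.2 hp0).ne'
    ENNReal.ofReal_ne_top, ENNReal.toReal_ofReal hp0.le, one_div]
  simp only [hΔ]
  refine (ENNReal.rpow_le_rpow (lintegral_rpow_Qopt_sub_Qπ_le hR hk hkJ hπstar hQ h0 hπ ρ hp)
    (inv_nonneg.2 hp0.le)).trans ?_
  rw [ENNReal.mul_rpow_of_nonneg _ _ (inv_nonneg.2 hp0.le), ENNReal.rpow_rpow_inv hp0.ne']
  refine mul_le_mul_right ((ENNReal.rpow_add_le_add_rpow _ _ (inv_nonneg.2 hp0.le)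
    (inv_le_one_of_one_le₀ hp)).trans_eq ?_) _
  rw [ENNReal.mul_rpow_of_nonneg _ _ (inv_nonneg.2 hp0.le), ENNReal.rpow_rpow_inv hp0.ne', hγJ,
    add_comm]

lemma abs_Qopt_sub_le (hR : ∀ x, |M.r x| ≤ Rmax) (hk : 1 ≤ k) {f : S × A → ℝ}
    (hf : ∀ x, |f x| ≤ Rmax / (1 - M.γ)) (x : S × A) :
    |M.Qopt k x - f x| ≤ 2 / (1 - M.γ) * Rmax :=
  ((abs_sub _ _).trans (add_le_add (abs_Qopt_le hR hk x) (hf x))).trans_eq (by ring)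

end NormBound

end MDP

lemma Policy.exists_isGreedy_seq {S A : Type*} [MeasurableSpace S] [MeasurableSpace A] [Finite A]
    [Nonempty A] {Q : ℕ → S × A → ℝ} {J : ℕ} (hQ : ∀ j ≤ J, Measurable (Q j)) {πJ : Policy S A}
    (hπJ : πJ.IsGreedy (Q J)) :
    ∃ π : ℕ → Policy S A, (∀ j ≤ J, (π j).IsGreedy (Q j)) ∧ π J = πJ := by
  have : Nonempty (Policy S A) := ⟨πJ⟩
  choose! π hπ using fun j (hj : j ≤ J) => Policy.exists_isGreedy (hQ j hj)
  refine ⟨Function.update π J πJ, fun j hj => ?_, Function.update_self J πJ π⟩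
  obtain rfl | hjJ := eq_or_ne j J
  · rwa [Function.update_self]
  · rw [Function.update_of_ne hjJ]
    exact hπ j hj

end

theorem theorem5p1_general {S A : Type*} [MeasurableSpace S] [MeasurableSpace A]
    [Finite A] (M : MDP S A) (Rmax : ℝ) (hR : ∀ x, |M.r x| ≤ Rmax)
    (p : ℝ) (hp : 1 ≤ p) (k J : ℕ) (hk : 1 ≤ k) (hkJ : k ∣ J)
    (ρ ν : Measure (S × A)) [IsProbabilityMeasure ρ] [SigmaFinite ν]
    (Q : ℕ → S × A → ℝ) (hQ : ∀ j ≤ J, BddMeasurable (Q j))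
    (hQ0 : ∀ x, |Q 0 x| ≤ Rmax / (1 - M.γ))
    (πJ : Policy S A) (hπJ : πJ.IsGreedy (Q J))
    (πstar : Policy S A) (hπstar : πstar.IsGreedy (M.Qopt k))
    (r : ℝ) (q : ℝ≥0∞) (hq : 1 ≤ q)
    (h_indet : M.CVI k πstar ρ ν J r q = ⊤ → M.errAgg p ν J (M.err k Q) r q ≠ 0) :
    eLpNorm (fun x => M.Qopt k x - M.Qπ k πJ x) (ENNReal.ofReal p) ρ ≤
      ENNReal.ofReal (2 * M.γ ^ k / ((1 - M.γ) * (1 - M.γ ^ k))) *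
        (ENNReal.ofReal (2 / (1 - M.γ) * M.γ ^ ((J : ℝ) / p) * Rmax) +
          M.CVI k πstar ρ ν J r q ^ (1 / (2 * p)) *
            M.errAgg p ν J (M.err k Q) r q ^ (1 / (2 * p))) := by
  have : Nonempty A := (nonempty_of_isProbabilityMeasure ρ).map Prod.snd
  have hp0 : 0 < p := zero_lt_one.trans_le hp
  obtain ⟨π, hπ, rfl⟩ := Policy.exists_isGreedy_seq (fun j hj => (hQ j hj).measurable) hπJ
  have hbound := MDP.eLpNorm_Qopt_sub_Qπ_le hR hk hkJ hπstar hQ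
    (MDP.abs_Qopt_sub_le hR hk hQ0) hπ ρ hp
  rw [← ENNReal.ofReal_mul (Real.rpow_nonneg M.γ_nonneg _), ← mul_assoc,
    mul_comm (M.γ ^ ((J : ℝ) / p))] at hbound
  obtain hγ | hγ := M.γ_nonneg.eq_or_lt
  · refine hbound.trans_eq ?_
    simp only [← hγ, zero_pow (Nat.one_le_iff_ne_zero.1 hk), mul_zero, zero_div,
      ENNReal.ofReal_zero, zero_mul]
  refine hbound.trans (mul_le_mul_right (add_le_add_right ?_ _) _)
  rw [← ENNReal.mul_rpow_of_nonneg _ _ (by positivity)]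
  obtain hC | hC := eq_or_ne (M.CVI k πstar ρ ν J r q) ⊤
  · rw [hC, ENNReal.top_mul (h_indet hC), ENNReal.top_rpow_of_pos (by positivity)]
    exact le_top
  · rw [← one_div_mul_one_div, ENNReal.rpow_mul, one_div p,
      ENNReal.mul_rpow_of_nonneg _ _ one_half_pos.le]
    exact ENNReal.rpow_le_rpow (MDP.sum_α_mul_lintegral_le_CVI_mul_errAgg hγ hk hp0 hq hC
      (fun j hj => (MDP.bddMeasurable_err hR hQ hj).measurable) π) (inv_nonneg.2 hp0.le)

theorem theorem5p1 {S A : Type*} [MeasurableSpace S] [MeasurableSpace A]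
    [Finite A] [MeasurableSingletonClass A] (M : MDP S A)
    (Rmax : ℝ) (hR : ∀ x, |M.r x| ≤ Rmax)
    (p : ℝ) (hp : 1 ≤ p) (k J : ℕ) (hk : 1 ≤ k) (hJ : 1 ≤ J) (hkJ : J % k = 0)
    (ρ ν : Measure (S × A)) [IsProbabilityMeasure ρ] [IsProbabilityMeasure ν]
    (Q : ℕ → S × A → ℝ) (hQmeas : ∀ j ≤ J, Measurable (Q j))
    (Qmax : ℝ) (hQmax : Qmax ≤ Rmax / (1 - M.γ)) (hQ : ∀ j ≤ J, ∀ x, |Q j x| ≤ Qmax)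
    (πJ : Policy S A) (hπJ : πJ.IsGreedy (Q J))
    (πstar : Policy S A) (hπstar : πstar.IsGreedy (M.Qopt k))
    (r : ℝ) (hr : r ∈ Set.Icc (0 : ℝ) 1) (q : ℝ≥0∞) (hq : 1 ≤ q)
    -- the product of the two factors below is not of the form `∞ · 0`, which would mean `∞` here
    (h_indet : M.CVI k πstar ρ ν J r q = ⊤ → M.errAgg p ν J (M.err k Q) r q ≠ 0) :
    eLpNorm (fun x => M.Qopt k x - M.Qπ k πJ x) (ENNReal.ofReal p) ρ ≤
      ENNReal.ofReal (2 * M.γ ^ k / ((1 - M.γ) * (1 - M.γ ^ k))) *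
        (ENNReal.ofReal (2 / (1 - M.γ) * M.γ ^ ((J : ℝ) / p) * Rmax) +
          M.CVI k πstar ρ ν J r q ^ (1 / (2 * p)) *
            M.errAgg p ν J (M.err k Q) r q ^ (1 / (2 * p))) :=
  theorem5p1_general M Rmax hR p hp k J hk (Nat.dvd_of_mod_eq_zero hkJ) ρ ν Q
    (fun j hj => ⟨hQmeas j hj, Qmax, hQ j hj⟩)
    (fun x => (hQ 0 J.zero_le x).trans hQmax) πJ hπJ πstar hπstar r q hq h_indet
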